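/- Let $\mathfrak g$ be a simple finite-dimensional complex Lie algebra with Chevalley generators $e_i,f_i,\check\alpha_i$ ($i=1,\dots,r$), simple roots $\alpha_i$ and Cartan matrix $a_{ij}=\langle\alpha_j,\check\alpha_i\rangle$. Let $G$ be the connected, simply connected simple algebraic group over $\mathbb C$ with Lie algebra $\mathfrak g$, with the corresponding maximal torus $H$ and opposite Borel subgroups $B_\pm$ (with Lie algebras $\mathfrak b_\pm$), and let $V_i$ be the irreducible representation with highest weight the fundamental weight $\omega_i$, $\nu_{\omega_i}\in V_i$ a highest weight vector, and $W_i=\mathrm{span}(\nu_{\omega_i},f_i\nu_{\omega_i})$, a $B_+$-stable plane. Write $G(z),B_\pm(z),\mathfrak g(z),\dots$ for the points over $\mathbb C(z)$. Fix monic polynomials $\Lambda_1,\dots,\Lambda_r\in\mathbb C[z]$ and $Z^H=\sum_i\zeta_i\check\alpha_i$ with $\zeta_i\in\mathbb C$. **Opers.** All bundles are considered at the generic point of $\mathbb P^1$. A Miura $G$-oper (with regular singularities determined by the $\Lambda_i$) is a connection $\nabla=\partial_z+A(z)$, $A\in\mathfrak g(z)$, with reductions to $B_-$ and $B_+$ given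 by cosets in $G(z)/B_-(z)$ and $G(z)/B_+(z)$, such that in some trivialization of the $B_-$-reduction $\nabla=\partial_z+\sum_i\Lambda_i(z)e_i+b(z)$ with $b\in\mathfrak b_-(z)$, and in some trivialization of the $B_+$-reduction the connection matrix lies in $\mathfrak b_+(z)$. Miura opers are identified if they are isomorphic on some nonempty open subset of $\mathbb P^1$, i.e. if some $g(z)\in G(z)$ carries the connection and both reductions of one to those of the other. A Miura oper is a *$Z^H$-twisted Miura–Plücker oper* if there is a trivialization of its $B_+$-reduction in which, for every $i$, the connection induced on $W_i$ is $\partial_z+Z^H|_{W_i}$. Rational functions $y_1,\dots,y_r\ne0$ satisfy *condition (N)* if: no $y_i$ has a multiple zero or pole; the roots of $\Lambda_i$ are distinct from the zeros and poles of $y_i$ for all $i$; and for $i\neq j$ with $a_{ij}\ne0$ the zeros and poles of $y_i$ are distinct from those of $y_j$. A $Z^H$-twisted Miura–Plücker oper is *nondegenerate* if, in a trivialization compatible with both reductions, $\nabla=\partial_z+\sum_i u_i\check\alpha_i+\sum_i\Lambda_ie_i$ with $u_i=\zeta_i-y_i^{-1}\partial_zy_i$ for some $y_1,\dots,y_r$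 satisfying (N), and each Miura $\mathrm{SL}(2)$-oper $\partial_z+u_i\check\alpha_i+\rho_ie_i$, $\rho_i=\Lambda_i\prod_{k\ne i}y_k^{-a_{ki}}$, is nondegenerate; the latter means that $\rho_i$ is a nonzero polynomial and $u_i=\zeta_i-y^{-1}\partial_zy$ for a nonzero polynomial $y$ without multiple roots and without common roots with $\rho_i$. **The $qq$-system.** It is the system $$q_+^i\,\partial_zq_-^i-q_-^i\,\partial_zq_+^i+\langle\alpha_i,Z^H\rangle\,q_+^iq_-^i=\Lambda_i\prod_{j\ne i}(q_+^j)^{-a_{ji}},\qquad i=1,\dots,r.$$ A polynomial solution $\{q_+^i,q_-^i\}$ is *nondegenerate* if every $q_+^i$ is monic and $q_+^1,\dots,q_+^r$ satisfy (N). **Statement.** The map sending $\{q_+^i,q_-^i\}$ to the (class of the) Miura oper with the standard reductions $B_-$, $B_+$ and connection $$\nabla=\partial_z+\sum_i\big[\zeta_i-(q_+^i)^{-1}\partial_zq_+^i\big]\check\alpha_i+\sum_i\Lambda_ie_i$$ is a well-defined surjection from the set of nondegenerate polynomial solutions of the $qq$-system onto the set of nondegenerate $Z^H$-twisted Miura–Plücker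 opers, and its fibres consist of all solutions with fixed $q_+^i$'s: two solutions have the same image if and only if they have the same $q_+^1,\dots,q_+^r$. -/

import Mathlib

set_option linter.unusedSectionVars false

open Polynomial TensorProduct

namespace MiuraOpers

noncomputable section

/-! ### The differential field of rational functions -/

/-- The derivative of a rational function, by the quotient rule. -/
def ratDerivFun (f : RatFunc ℂ) : RatFunc ℂ :=
  (algebraMap ℂ[X] (RatFunc ℂ) (derivative f.num) * algebraMap ℂ[X] (RatFunc ℂ) f.denom
    - algebraMap ℂ[X] (RatFunc ℂ) f.num * algebraMap ℂ[X] (RatFunc ℂ) (derivative f.denom))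
    / algebraMap ℂ[X] (RatFunc ℂ) f.denom ^ 2

/-- The quotient rule holds for every way of writing a rational function as a fraction. -/
theorem ratDerivFun_div (p q : ℂ[X]) (hq : q ≠ 0) :
    ratDerivFun (algebraMap ℂ[X] (RatFunc ℂ) p / algebraMap ℂ[X] (RatFunc ℂ) q) =
      (algebraMap ℂ[X] (RatFunc ℂ) (derivative p) * algebraMap ℂ[X] (RatFunc ℂ) q
        - algebraMap ℂ[X] (RatFunc ℂ) p * algebraMap ℂ[X] (RatFunc ℂ) (derivative q))
        / algebraMap ℂ[X] (RatFunc ℂ) q ^ 2 := by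
  set f := algebraMap ℂ[X] (RatFunc ℂ) p / algebraMap ℂ[X] (RatFunc ℂ) q with hf
  have hd : f.denom ≠ 0 := f.denom_ne_zero
  have h1 : algebraMap ℂ[X] (RatFunc ℂ) q ≠ 0 := RatFunc.algebraMap_ne_zero hq
  have h2 : algebraMap ℂ[X] (RatFunc ℂ) f.denom ≠ 0 := RatFunc.algebraMap_ne_zero hd
  have key : f.num * q = p * f.denom := by
    apply RatFunc.algebraMap_injective ℂ
    have h3 : algebraMap ℂ[X] (RatFunc ℂ) f.num / algebraMap ℂ[X] (RatFunc ℂ) f.denom = f :=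
      RatFunc.num_div_denom f
    rw [map_mul, map_mul]
    exact (div_eq_div_iff h2 h1).1 (h3.trans hf)
  have key' : derivative f.num * q + f.num * derivative q
      = derivative p * f.denom + p * derivative f.denom := by
    simpa [derivative_mul] using congrArg derivative key
  have k1 := congrArg (algebraMap ℂ[X] (RatFunc ℂ)) key
  have k2 := congrArg (algebraMap ℂ[X] (RatFunc ℂ)) key'
  simp only [map_mul, map_add] at k1 k2
  rw [ratDerivFun, div_eq_div_iff (pow_ne_zero 2 h2) (pow_ne_zero 2 h1)]
  linear_combination (algebraMap ℂ[X] (RatFunc ℂ) q * algebraMap ℂ[X] (RatFunc ℂ) f.denom) * k2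
    - (algebraMap ℂ[X] (RatFunc ℂ) q * algebraMap ℂ[X] (RatFunc ℂ) (derivative f.denom)
      + algebraMap ℂ[X] (RatFunc ℂ) f.denom * algebraMap ℂ[X] (RatFunc ℂ) (derivative q)) * k1

/-- Every rational function is a fraction of polynomials. -/
theorem exists_fraction (f : RatFunc ℂ) : ∃ p q : ℂ[X], q ≠ 0 ∧
    f = algebraMap ℂ[X] (RatFunc ℂ) p / algebraMap ℂ[X] (RatFunc ℂ) q :=
  ⟨f.num, f.denom, f.denom_ne_zero, (RatFunc.num_div_denom f).symm⟩

/-- `∂_z` as a `ℂ`-linear map of `ℂ(z)`. -/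
def ratDeriv : RatFunc ℂ →ₗ[ℂ] RatFunc ℂ where
  toFun := ratDerivFun
  map_add' f g := by
    obtain ⟨p, q, hq, rfl⟩ := exists_fraction f
    obtain ⟨r, s, hs, rfl⟩ := exists_fraction g
    have h1 : algebraMap ℂ[X] (RatFunc ℂ) q ≠ 0 := RatFunc.algebraMap_ne_zero hq
    have h2 : algebraMap ℂ[X] (RatFunc ℂ) s ≠ 0 := RatFunc.algebraMap_ne_zero hs
    rw [div_add_div _ _ h1 h2, ← map_mul, ← map_mul, ← map_mul, ← map_add,
      ratDerivFun_div _ _ (mul_ne_zero hq hs), ratDerivFun_div _ _ hq, ratDerivFun_div _ _ hs]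
    simp only [derivative_mul, map_mul, map_add]
    field_simp
    ring
  map_smul' a f := by
    obtain ⟨p, q, hq, rfl⟩ := exists_fraction f
    have h1 : algebraMap ℂ[X] (RatFunc ℂ) q ≠ 0 := RatFunc.algebraMap_ne_zero hq
    have hsm : ∀ x : RatFunc ℂ, a • x = algebraMap ℂ[X] (RatFunc ℂ) (C a) * x := by
      intro x
      rw [Algebra.smul_def, IsScalarTower.algebraMap_apply ℂ ℂ[X] (RatFunc ℂ)]
      rfl
    rw [hsm, RingHom.id_apply, hsm, ← mul_div_assoc, ← map_mul, ratDerivFun_div _ _ hq,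
      ratDerivFun_div _ _ hq]
    simp only [derivative_C_mul, map_mul]
    ring

/-! ### Nondegeneracy conditions on families of rational functions -/

/-- The set of zeros and poles in `ℂ` of a (nonzero) rational function. -/
def zerosAndPoles (y : RatFunc ℂ) : Set ℂ :=
  {w | y.num.IsRoot w ∨ y.denom.IsRoot w}

/-- The three conditions of `H`-nondegeneracy on the functions `y i`, relative to the functions
`Λ i` and to a Cartan matrix `a`: no `y i` has multiple zeros or poles; the zeros of `Λ i` are
distinct from the zeros and poles of `y i`; and for `i ≠ j` with `a i j ≠ 0` the zeros and poles of
`y i` are distinct from those of `y j`. -/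
structure HNondegConditions {ι : Type*} (a : ι → ι → ℤ) (Λ y : ι → RatFunc ℂ) : Prop where
  ne_zero : ∀ i, y i ≠ 0
  simple : ∀ i w, (y i).num.rootMultiplicity w ≤ 1 ∧ (y i).denom.rootMultiplicity w ≤ 1
  disjoint_sing : ∀ i w, (Λ i).num.IsRoot w → w ∉ zerosAndPoles (y i)
  disjoint_adj : ∀ i j, i ≠ j → a i j ≠ 0 → Disjoint (zerosAndPoles (y i)) (zerosAndPoles (y j))

/-- The Miura `SL(2)`-oper `∂_z + u(z) α̌ + ρ(z) e` with twist `ζ α̌` is nondegenerate: it has regular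
singularities (`ρ` is a nonzero polynomial), and `u = ζ - y⁻¹ ∂_z y` for a polynomial `y` satisfying
the conditions of `H`-nondegeneracy. -/
def IsNondegenerateSL2 (ζ : ℂ) (u ρ : RatFunc ℂ) : Prop :=
  (∃ p : ℂ[X], p ≠ 0 ∧ ρ = algebraMap ℂ[X] (RatFunc ℂ) p) ∧
  ∃ y : ℂ[X],
    u = RatFunc.C ζ - (algebraMap ℂ[X] (RatFunc ℂ) y)⁻¹ * ratDeriv (algebraMap ℂ[X] (RatFunc ℂ) y) ∧
    HNondegConditions (fun _ _ : Unit => 2) (fun _ => ρ) (fun _ => algebraMap ℂ[X] (RatFunc ℂ) y)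

/-! ### The simple group over `ℂ(z)`

`L` is the simple Lie algebra and `c : LieAlgebra.Basis ι H` a choice of Chevalley generators `c.e i`,
`c.f i`, with simple coroots `c.h i` spanning the Cartan subalgebra `H`. In Mathlib's convention
`⁅c.h j, c.e i⁆ = c.A i j • c.e i`, that is `c.A i j = ⟨α_i, α̌_j⟩`. -/

section Group

variable {ι : Type*} [Fintype ι] [DecidableEq ι]
  {L : Type*} [LieRing L] [LieAlgebra ℂ L] {H : LieSubalgebra ℂ L}
  (c : LieAlgebra.Basis ι H)

/-- The Cartan matrix `a_{ij} = ⟨α_j, α̌_i⟩`. -/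
def cartan (i j : ι) : ℤ := c.A j i

/-- The pairing `⟨α_i, Z^H⟩` for `Z^H = ∑ ζ_j α̌_j`. -/
def rootPairing (ζ : ι → ℂ) (i : ι) : ℂ := ∑ j, (cartan c j i : ℂ) * ζ j

/-- `𝔟₊`, generated by the `e_i` and the `α̌_i`. -/
def lieBorelPlus : LieSubalgebra ℂ L :=
  LieSubalgebra.lieSpan ℂ L (Set.range c.e ∪ Set.range c.h)

/-- `𝔟₋`, generated by the `f_i` and the `α̌_i`. -/
def lieBorelMinus : LieSubalgebra ℂ L :=
  LieSubalgebra.lieSpan ℂ L (Set.range c.f ∪ Set.range c.h)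

/-- `M` is the irreducible finite-dimensional representation with highest weight the fundamental
weight `ω_i`, and `ν` is a highest weight vector. -/
structure IsFundamentalRep (i : ι) (M : Type*) [AddCommGroup M] [Module ℂ M] [LieRingModule L M]
    [LieModule ℂ L M] (ν : M) : Prop where
  finiteDimensional : FiniteDimensional ℂ M
  irreducible : LieModule.IsIrreducible ℂ L M
  ne_zero : ν ≠ 0
  raise : ∀ j, ⁅c.e j, ν⁆ = 0
  weight : ∀ j, ⁅c.h j, ν⁆ = if j = i then ν else 0

variable (V : ι → Type*) [∀ i, AddCommGroup (V i)] [∀ i, Module ℂ (V i)]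
  [∀ i, LieRingModule L (V i)] [∀ i, LieModule ℂ L (V i)]

/-- The group `∏ GL(V_i)(ℂ(z))`. When the `V_i` are the fundamental representations, the simply
connected group `G` acts faithfully on `⨁ V_i`, so that `G(ℂ(z))` is a subgroup of it. -/
abbrev Ambient := ∀ i, (RatFunc ℂ ⊗[ℂ] V i) ≃ₗ[RatFunc ℂ] (RatFunc ℂ ⊗[ℂ] V i)

variable {V}

/-- The action of `t x`, for `x ∈ L` and `t ∈ ℂ(z)`, on `M ⊗ ℂ(z)`. -/
def scaledAction (M : Type*) [AddCommGroup M] [Module ℂ M] [LieRingModule L M] [LieModule ℂ L M]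
    (x : L) (t : RatFunc ℂ) : Module.End (RatFunc ℂ) (RatFunc ℂ ⊗[ℂ] M) :=
  LieModule.toEnd (RatFunc ℂ) (RatFunc ℂ ⊗[ℂ] L) (RatFunc ℂ ⊗[ℂ] M) (t ⊗ₜ[ℂ] x)

/-- `g = exp(t x)`, for `x ∈ L` acting nilpotently and `t ∈ ℂ(z)`. -/
def IsExp (x : L) (t : RatFunc ℂ) (g : Ambient V) : Prop :=
  ∀ j, ∃ N : ℕ, scaledAction (V j) x t ^ N = 0 ∧
    ∀ w, g j w = ∑ n ∈ Finset.range N, ((n.factorial : RatFunc ℂ)⁻¹) • (scaledAction (V j) x t ^ n) w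

/-- `g = t ^ α̌_i`, for `t ∈ ℂ(z)ˣ`: a vector on which `α̌_i` has the eigenvalue `n ∈ ℤ` is multiplied
by `t ^ n`. -/
def IsCocharacter (i : ι) (t : (RatFunc ℂ)ˣ) (g : Ambient V) : Prop :=
  ∀ (j : ι) (n : ℤ) (x : V j), ⁅c.h i, x⁆ = (n : ℂ) • x →
    g j (1 ⊗ₜ[ℂ] x) = ((t ^ n : (RatFunc ℂ)ˣ) : RatFunc ℂ) ⊗ₜ[ℂ] x

variable (V)

/-- The elements `t ^ α̌_i`, which generate `H(ℂ(z))`. -/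
def torusElements : Set (Ambient V) := {g | ∃ i t, IsCocharacter c i t g}

/-- The elements `exp(t e_i)`, which generate `N₊(ℂ(z))`. -/
def raisingElements : Set (Ambient V) := {g | ∃ i t, IsExp (c.e i) t g}

/-- The elements `exp(t f_i)`, which generate `N₋(ℂ(z))`. -/
def loweringElements : Set (Ambient V) := {g | ∃ i t, IsExp (c.f i) t g}

/-- The group `G(ℂ(z))` of `ℂ(z)`-points of the connected simply connected simple group with Lie
algebra `L`, generated by its maximal torus and its simple root subgroups. -/
def Gz : Subgroup (Ambient V) :=
  Subgroup.closure (torusElements c V ∪ raisingElements c V ∪ loweringElements c V)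

/-- The Borel subgroup `B₊(ℂ(z))` of `G(ℂ(z))`. -/
def borelPlus : Subgroup (Gz c V) :=
  (Subgroup.closure (torusElements c V ∪ raisingElements c V)).subgroupOf (Gz c V)

/-- The Borel subgroup `B₋(ℂ(z))` of `G(ℂ(z))`. -/
def borelMinus : Subgroup (Gz c V) :=
  (Subgroup.closure (torusElements c V ∪ loweringElements c V)).subgroupOf (Gz c V)

/-! ### Connections and gauge transformations -/

variable {V}

/-- The operator `∂_z + A(z)` on `V_i ⊗ ℂ(z)`, for `A(z) ∈ 𝔤(z)`. -/
def nabla (A : RatFunc ℂ ⊗[ℂ] L) (i : ι) (w : RatFunc ℂ ⊗[ℂ] V i) : RatFunc ℂ ⊗[ℂ] V i :=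
  ratDeriv.rTensor (V i) w + ⁅A, w⁆

/-- `∂_z + A = g (∂_z + B) g⁻¹`, as an identity of operators on every `V_i ⊗ ℂ(z)`. -/
def IsGauge (g : Ambient V) (A B : RatFunc ℂ ⊗[ℂ] L) : Prop :=
  ∀ i w, nabla A i (g i w) = g i (nabla B i w)

theorem IsGauge.one (A : RatFunc ℂ ⊗[ℂ] L) : IsGauge (1 : Ambient V) A A := fun _ _ => rfl

theorem IsGauge.mul {g h : Ambient V} {A B D : RatFunc ℂ ⊗[ℂ] L}
    (h1 : IsGauge g A B) (h2 : IsGauge h B D) : IsGauge (g * h) A D := fun i w => by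
  change nabla A i (g i (h i w)) = g i (h i (nabla D i w))
  rw [h1, h2]

theorem IsGauge.inv {g : Ambient V} {A B : RatFunc ℂ ⊗[ℂ] L}
    (h1 : IsGauge g A B) : IsGauge g⁻¹ B A := fun i w => by
  change nabla B i ((g i).symm w) = (g i).symm (nabla A i w)
  rw [LinearEquiv.eq_symm_apply, ← h1, LinearEquiv.apply_symm_apply]

/-! ### Miura opers

At the generic point of the projective line a `G`-bundle is trivial. A meromorphic connection is
`∂_z + A(z)` in a trivialization, and a reduction to `B_±` is a coset `g(z) B_±(z)`; the elements of
this coset are the trivializations of the reduction. -/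

variable (V)

/-- A connection on the trivial `G`-bundle with reductions to `B₋` and to `B₊`. -/
structure PreOper where
  conn : RatFunc ℂ ⊗[ℂ] L
  redMinus : Gz c V ⧸ borelMinus c V
  redPlus : Gz c V ⧸ borelPlus c V

variable {c V}

/-- In some trivialization of the reduction to `B₋` the connection is
`∂_z + ∑ φ_i(z) e_i + b(z)` with `b(z) ∈ 𝔟₋(z)`. -/
def PreOper.HasOperForm (x : PreOper c V) (φ : ι → RatFunc ℂ) : Prop :=
  ∃ g : Gz c V, (g : Gz c V ⧸ borelMinus c V) = x.redMinus ∧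
    ∃ b ∈ (lieBorelMinus c).baseChange (RatFunc ℂ),
      IsGauge (g : Ambient V) x.conn ((∑ i, φ i ⊗ₜ[ℂ] c.e i) + b)

/-- The oper condition: all the simple root components `φ_i` are nonzero. -/
def PreOper.IsOper (x : PreOper c V) : Prop :=
  ∃ φ : ι → RatFunc ℂ, (∀ i, φ i ≠ 0) ∧ x.HasOperForm φ

/-- The oper has regular singularities determined by the polynomials `Λ_i`. -/
def PreOper.HasRegularSingularities (x : PreOper c V) (Λ : ι → ℂ[X]) : Prop :=
  x.HasOperForm fun i => algebraMap ℂ[X] (RatFunc ℂ) (Λ i)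

/-- The connection preserves the reduction to `B₊`. -/
def PreOper.PreservesPlus (x : PreOper c V) : Prop :=
  ∃ g : Gz c V, (g : Gz c V ⧸ borelPlus c V) = x.redPlus ∧
    ∃ A ∈ (lieBorelPlus c).baseChange (RatFunc ℂ), IsGauge (g : Ambient V) x.conn A

variable (c V)

/-- Miura `G`-opers with regular singularities determined by the polynomials `Λ_i`. -/
structure MiuraOper (Λ : ι → ℂ[X]) extends PreOper c V where
  isOper : toPreOper.IsOper
  regular : toPreOper.HasRegularSingularities Λ
  preserves : toPreOper.PreservesPlus

variable {c V} {Λ : ι → ℂ[X]}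

/-- Isomorphism of Miura opers (over a nonempty open subset of the projective line): a gauge
transformation matching the connections and both reductions. -/
def MiuraOper.Iso (x y : MiuraOper c V Λ) : Prop :=
  ∃ g : Gz c V, IsGauge (g : Ambient V) x.conn y.conn ∧
    x.redMinus = g • y.redMinus ∧ x.redPlus = g • y.redPlus

variable (c V Λ)

instance MiuraOper.setoid : Setoid (MiuraOper c V Λ) where
  r := MiuraOper.Iso
  iseqv :=
    { refl := fun x => ⟨1, IsGauge.one _, (one_smul _ _).symm, (one_smul _ _).symm⟩
      symm := fun ⟨g, h1, h2, h3⟩ => ⟨g⁻¹, h1.inv, by rw [h2, inv_smul_smul],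
        by rw [h3, inv_smul_smul]⟩
      trans := fun ⟨g, h1, h2, h3⟩ ⟨h, k1, k2, k3⟩ => ⟨g * h, h1.mul k1, by rw [h2, k2, mul_smul],
        by rw [h3, k3, mul_smul]⟩ }

/-- Isomorphism classes of Miura opers. -/
abbrev MiuraOperClass := Quotient (MiuraOper.setoid c V Λ)

variable {V Λ}

/-- The semisimple element `Z^H = ∑ ζ_i α̌_i`. -/
def twist (ζ : ι → ℂ) : L := ∑ i, ζ i • c.h i

/-- The plane `W_i ⊂ V_i` spanned by `ν_{ω_i}` and `f_i ν_{ω_i}`. -/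
def plane (ν : ∀ i, V i) (i : ι) : Submodule ℂ (V i) :=
  Submodule.span ℂ {ν i, ⁅c.f i, ν i⁆}

variable {c}

/-- The Miura oper is a `Z`-twisted Miura–Plücker oper: there is a trivialization `g` of the reduction
to `B₊` in which the connection induced on each `W_i` is `∂_z + Z|_{W_i}`. -/
def MiuraOper.IsTwistedMiuraPlucker (x : MiuraOper c V Λ) (ν : ∀ i, V i) (Z : L) : Prop :=
  ∃ g : Gz c V, (g : Gz c V ⧸ borelPlus c V) = x.redPlus ∧
    ∀ i, ∀ w ∈ (plane c ν i).baseChange (RatFunc ℂ),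
      nabla x.conn i ((g : Ambient V) i w) = (g : Ambient V) i (nabla (1 ⊗ₜ[ℂ] Z) i w)

variable (c Λ)

/-- The connection matrix `∑ u_i(z) α̌_i + ∑ Λ_i(z) e_i`. -/
def miuraForm (u : ι → RatFunc ℂ) : RatFunc ℂ ⊗[ℂ] L :=
  (∑ i, u i ⊗ₜ[ℂ] c.h i) + ∑ i, algebraMap ℂ[X] (RatFunc ℂ) (Λ i) ⊗ₜ[ℂ] c.e i

variable {c Λ}

/-- In a trivialization compatible with both reductions, the connection is
`∂_z + ∑ u_i(z) α̌_i + ∑ Λ_i(z) e_i`. The associated Cartan connection is `∂_z + ∑ u_i(z) α̌_i`. -/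
def MiuraOper.HasMiuraForm (x : MiuraOper c V Λ) (u : ι → RatFunc ℂ) : Prop :=
  ∃ g : Gz c V, (g : Gz c V ⧸ borelMinus c V) = x.redMinus ∧
    (g : Gz c V ⧸ borelPlus c V) = x.redPlus ∧
    IsGauge (g : Ambient V) x.conn (miuraForm c Λ u)

variable (c Λ)

/-- `ρ_i = Λ_i ∏_{k ≠ i} y_k ^ (-a_{ki})`. -/
def rho (y : ι → RatFunc ℂ) (i : ι) : RatFunc ℂ :=
  algebraMap ℂ[X] (RatFunc ℂ) (Λ i) * ∏ k ∈ Finset.univ.erase i, y k ^ (-cartan c k i)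

variable {c Λ}

/-- Nondegeneracy of a Miura–Plücker oper with twist `Z^H = ∑ ζ_i α̌_i`: it is `H`-nondegenerate, its
Cartan connection being given by `u_i = ζ_i - y_i⁻¹ ∂_z y_i`, and each of the associated Miura
`SL(2)`-opers `∂_z + u_i α̌_i + ρ_i e_i` is nondegenerate. -/
def MiuraOper.IsNondegenerate (x : MiuraOper c V Λ) (ζ : ι → ℂ) : Prop :=
  ∃ u y : ι → RatFunc ℂ, x.HasMiuraForm u ∧
    (∀ i, u i = RatFunc.C (ζ i) - (y i)⁻¹ * ratDeriv (y i)) ∧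
    HNondegConditions (cartan c) (fun i => algebraMap ℂ[X] (RatFunc ℂ) (Λ i)) y ∧
    ∀ i, IsNondegenerateSL2 (ζ i) (u i) (rho c Λ y i)

variable (c Λ)

/-- The isomorphism classes of nondegenerate `Z^H`-twisted Miura–Plücker opers. -/
def NondegMiuraPluckerOpers (ν : ∀ i, V i) (ζ : ι → ℂ) : Set (MiuraOperClass c V Λ) :=
  {o | ∃ x : MiuraOper c V Λ, (⟦x⟧ : MiuraOperClass c V Λ) = o ∧
    x.IsTwistedMiuraPlucker ν (twist c ζ) ∧ x.IsNondegenerate ζ}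

/-! ### The `qq`-system -/

/-- Polynomial solutions of the `qq`-system. The exponents `-a_{ji}`, `j ≠ i`, are natural numbers. -/
structure QQSolution (ζ : ι → ℂ) where
  qPlus : ι → ℂ[X]
  qMinus : ι → ℂ[X]
  eqn : ∀ i, wronskian (qPlus i) (qMinus i) + C (rootPairing c ζ i) * (qPlus i * qMinus i)
    = Λ i * ∏ j ∈ Finset.univ.erase i, qPlus j ^ (-cartan c j i).toNat

variable {c Λ}

/-- A polynomial solution is nondegenerate if the `q₊^i` are monic and satisfy the conditions of
`H`-nondegeneracy. -/
def QQSolution.IsNondegenerate {ζ : ι → ℂ} (s : QQSolution c Λ ζ) : Prop :=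
  (∀ i, (s.qPlus i).Monic) ∧
    HNondegConditions (cartan c) (fun i => algebraMap ℂ[X] (RatFunc ℂ) (Λ i))
      (fun i => algebraMap ℂ[X] (RatFunc ℂ) (s.qPlus i))

/-- The functions `ζ_i - (q₊^i)⁻¹ ∂_z q₊^i`. -/
def QQSolution.cartanPart {ζ : ι → ℂ} (s : QQSolution c Λ ζ) (i : ι) : RatFunc ℂ :=
  RatFunc.C (ζ i) - (algebraMap ℂ[X] (RatFunc ℂ) (s.qPlus i))⁻¹ *
    ratDeriv (algebraMap ℂ[X] (RatFunc ℂ) (s.qPlus i))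

end Group

end

end MiuraOpers

open MiuraOpers

/-! Everything is decided on the planes `W_j`. An element of `B₊(z)` acts on them by upper
triangular matrices whose diagonals come from one tuple `t` of nonzero rational functions, with
off-diagonal entries `s_j` (`exists_actsOnPlanes_of_mem`), and every pair `(t, s)` occurs
(`exists_mem_actsOnPlanes`). Carrying `∂_z + Z^H` to `∂_z + ∑ u_k α̌_k + ∑ Λ_k e_k` on `W_j` amounts
to two scalar equations: `t_j'/t_j = ζ_j - u_j`, and a first-order linear equation for `s_j`. If
`u_j = ζ_j - q_j'/q_j`, the first says that `t_j` is a constant multiple of `q_j`. For `t = q` and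
`s_j = -q₋^j` the second reads `(q₋^j/q_j)' + ⟨α_j, Z^H⟩ q₋^j/q_j = ρ_j/q_j²`, which is the
`qq`-equation divided by `q_j²`. So a solution of the `qq`-system yields a twisted Miura–Plücker
oper.

For surjectivity, nondegeneracy of the `SL(2)`-opers makes the `y_j` polynomials up to constants,
and the Plücker condition supplies a rational solution of the last equation. It is a polynomial over
`q_j`: a pole of order `n > 0` in the solution becomes a pole of order `n + 1` in the left-hand
side, whereas `ρ_j/q_j²` has at most double poles, at the simple roots of `q_j`
(`exists_eq_div_of_ratDeriv_add_eq`). The numerator is `q₋^j` (`exists_qMinus`).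

For the fibres, an isomorphism between two standard opers lies in `B₊ ∩ B₋`, so it is diagonal on
each `W_j`. Preserving the coefficients `Λ_j` forces all simple roots to be `1` on it; invertibility
of the Cartan matrix then makes the `t_j` constant, so the Cartan connections agree
(`eq_of_standardOper_iso`). A monic polynomial is determined by its logarithmic derivative. -/

namespace MiuraOpers

/-! ### Calculus of rational functions -/

theorem ratDeriv_div (p q : ℂ[X]) (hq : q ≠ 0) :
    ratDeriv (algebraMap ℂ[X] (RatFunc ℂ) p / algebraMap ℂ[X] (RatFunc ℂ) q) =
      (algebraMap ℂ[X] (RatFunc ℂ) (derivative p) * algebraMap ℂ[X] (RatFunc ℂ) q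
        - algebraMap ℂ[X] (RatFunc ℂ) p * algebraMap ℂ[X] (RatFunc ℂ) (derivative q))
        / algebraMap ℂ[X] (RatFunc ℂ) q ^ 2 :=
  ratDerivFun_div p q hq

theorem ratDeriv_algebraMap (p : ℂ[X]) :
    ratDeriv (algebraMap ℂ[X] (RatFunc ℂ) p) = algebraMap ℂ[X] (RatFunc ℂ) (derivative p) := by
  simpa using ratDeriv_div p 1 one_ne_zero

theorem ratDeriv_C (a : ℂ) : ratDeriv (RatFunc.C a) = 0 := by
  rw [← RatFunc.algebraMap_C, ratDeriv_algebraMap, derivative_C, map_zero]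

theorem ratDeriv_one : ratDeriv (1 : RatFunc ℂ) = 0 := by
  simpa using ratDeriv_C 1

theorem ratDeriv_mul (f g : RatFunc ℂ) : ratDeriv (f * g) = ratDeriv f * g + f * ratDeriv g := by
  obtain ⟨p, q, hq, rfl⟩ := exists_fraction f
  obtain ⟨r, s, hs, rfl⟩ := exists_fraction g
  have h1 : algebraMap ℂ[X] (RatFunc ℂ) q ≠ 0 := RatFunc.algebraMap_ne_zero hq
  have h2 : algebraMap ℂ[X] (RatFunc ℂ) s ≠ 0 := RatFunc.algebraMap_ne_zero hs
  rw [div_mul_div_comm, ← map_mul, ← map_mul, ratDeriv_div _ _ (mul_ne_zero hq hs),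
    ratDeriv_div _ _ hq, ratDeriv_div _ _ hs]
  simp only [derivative_mul, map_mul, map_add]
  field_simp
  ring

theorem ratDeriv_inv {f : RatFunc ℂ} (hf : f ≠ 0) : ratDeriv f⁻¹ = -(ratDeriv f * f⁻¹ ^ 2) := by
  have h := ratDeriv_mul f f⁻¹
  rw [mul_inv_cancel₀ hf, ratDeriv_one] at h
  field_simp
  field_simp at h
  linear_combination -h

/-- In lowest terms `n/d`, a vanishing derivative means `n' d = n d'`. Coprimality gives `d ∣ d'`,
so `d' = 0` by degree, and then `n' = 0`. -/
theorem eq_C_of_ratDeriv_eq_zero {f : RatFunc ℂ} (hf : ratDeriv f = 0) :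
    ∃ a, f = RatFunc.C a := by
  have hd := f.denom_ne_zero
  have hD : algebraMap ℂ[X] (RatFunc ℂ) f.denom ≠ 0 := RatFunc.algebraMap_ne_zero hd
  have h := ratDeriv_div f.num f.denom hd
  rw [RatFunc.num_div_denom, hf, eq_comm, div_eq_zero_iff] at h
  have h' := h.resolve_right (pow_ne_zero 2 hD)
  rw [← map_mul, ← map_mul, ← map_sub] at h'
  have h2 : derivative f.num * f.denom - f.num * derivative f.denom = 0 :=
    RatFunc.algebraMap_injective ℂ (by rw [h', map_zero])
  have h3 : f.denom ∣ derivative f.denom :=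
    f.isCoprime_num_denom.symm.dvd_of_dvd_mul_left
      ⟨derivative f.num, by linear_combination -h2⟩
  have h4 : derivative f.denom = 0 := by
    by_contra h5
    exact (degree_derivative_lt hd).not_ge (degree_le_of_dvd h3 h5)
  have h5 : derivative f.num = 0 := by
    rw [h4, mul_zero, sub_zero] at h2
    exact (mul_eq_zero.1 h2).resolve_right hd
  have h6 := eq_C_of_derivative_eq_zero h4
  have h7 := eq_C_of_derivative_eq_zero h5
  refine ⟨f.num.coeff 0 / f.denom.coeff 0, ?_⟩
  conv_lhs => rw [← RatFunc.num_div_denom f, h6, h7]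
  rw [RatFunc.algebraMap_C, RatFunc.algebraMap_C, map_div₀]

/-- Rational functions with the same logarithmic derivative are proportional. -/
theorem exists_C_mul_of_logDeriv_eq {f g : RatFunc ℂ} (hf : f ≠ 0) (hg : g ≠ 0)
    (h : f⁻¹ * ratDeriv f = g⁻¹ * ratDeriv g) : ∃ a : ℂ, a ≠ 0 ∧ f = RatFunc.C a * g := by
  have h0 : ratDeriv (f * g⁻¹) = 0 := by
    rw [ratDeriv_mul, ratDeriv_inv hg]
    field_simp at h ⊢
    linear_combination h
  obtain ⟨a, ha⟩ := eq_C_of_ratDeriv_eq_zero h0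
  have h1 : f = RatFunc.C a * g := by rw [← ha]; field_simp
  refine ⟨a, ?_, h1⟩
  rintro rfl
  exact hf (by rw [h1, map_zero, zero_mul])

theorem logDeriv_C_mul {a : ℂ} (ha : a ≠ 0) (g : RatFunc ℂ) :
    (RatFunc.C a * g)⁻¹ * ratDeriv (RatFunc.C a * g) = g⁻¹ * ratDeriv g := by
  have : RatFunc.C a ≠ 0 := (_root_.map_ne_zero _).2 ha
  rw [ratDeriv_mul, ratDeriv_C, mul_inv]
  field_simp
  ring

theorem dvd_of_rootMultiplicity_le {p q : ℂ[X]} (hp : p ≠ 0) (hq : q ≠ 0)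
    (h : ∀ w, p.rootMultiplicity w ≤ q.rootMultiplicity w) : p ∣ q := by
  rw [(IsAlgClosed.splits p).dvd_iff_roots_le_roots hp hq, Multiset.le_iff_count]
  simpa using h

/-- Comparison of the multiplicities of a prime `p` on both sides of an identity `W(n, D) Q ^ 2 = ρ D ^ 2`,
where `W` is a twisted Wronskian, `D` has multiplicity `k + 1` and `Q` has multiplicity `m`. -/
theorem false_of_wronskian_mul_sq_eq {R : Type*} [CommRing R] [IsDomain R] {p : R} (hp : Prime p)
    {m k : ℕ} (hm : m ≤ 1) (hmk : m < k + 1) {n n' d d' a c q ρ : R}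
    (hn : ¬ p ∣ n) (hd : ¬ p ∣ a * d) (hq : ¬ p ∣ q)
    (h : (n' * (p ^ (k + 1) * d) - n * (p ^ k * (a * d + p * d')) + c * n * (p ^ (k + 1) * d))
      * (p ^ m * q) ^ 2 = ρ * (p ^ (k + 1) * d) ^ 2) : False := by
  -- The left side is divisible by `p` exactly `k + 2m` times, the right side at least `2(k + 1)`
  -- times. Since `2m ≤ k + 1`, at least one factor `p` is left over on the right.
  obtain ⟨z, hz⟩ := Nat.exists_eq_add_of_le (show k + 2 * m + 1 ≤ 2 * (k + 1) by omega)
  have e : p ^ (k + 2 * m) * ((n' * (p * d) - n * (a * d + p * d') + c * n * (p * d)) * q ^ 2)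
      = p ^ (k + 2 * m) * (p * (p ^ z * (ρ * d ^ 2))) := by
    have e1 : p ^ (k + 2 * m) * (p * (p ^ z * (ρ * d ^ 2))) = ρ * (p ^ (k + 1) * d) ^ 2 := by
      rw [mul_pow, ← pow_mul, mul_comm (k + 1) 2, hz]
      ring
    rw [e1, ← h]
    ring
  have e2 : p ∣ (n' * (p * d) - n * (a * d + p * d') + c * n * (p * d)) * q ^ 2 :=
    ⟨_, mul_left_cancel₀ (pow_ne_zero _ hp.ne_zero) e⟩
  rcases hp.dvd_or_dvd e2 with ⟨y, hy⟩ | h1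
  · rcases hp.dvd_or_dvd (show p ∣ n * (a * d) from
      ⟨n' * d - n * d' + c * n * d - y, by linear_combination -hy⟩) with h4 | h4
    · exact hn h4
    · exact hd h4
  · exact hq (hp.dvd_of_dvd_pow h1)

/-- A solution of `r' + κ r = ρ / q ^ 2`, where `ρ` and `q` are polynomials and `q` has only simple
roots, has at most simple poles, located at the roots of `q`. -/
theorem exists_eq_div_of_ratDeriv_add_eq {q ρ : ℂ[X]} (hq : q ≠ 0)
    (hs : ∀ w, q.rootMultiplicity w ≤ 1) (κ : ℂ) {r : RatFunc ℂ}
    (h : (ratDeriv r + RatFunc.C κ * r) * algebraMap ℂ[X] (RatFunc ℂ) q ^ 2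
      = algebraMap ℂ[X] (RatFunc ℂ) ρ) :
    ∃ p : ℂ[X], r = algebraMap ℂ[X] (RatFunc ℂ) p / algebraMap ℂ[X] (RatFunc ℂ) q := by
  set n := r.num with hn
  set d := r.denom with hd
  have hd0 : d ≠ 0 := r.denom_ne_zero
  have hD : algebraMap ℂ[X] (RatFunc ℂ) d ≠ 0 := RatFunc.algebraMap_ne_zero hd0
  have hQ : algebraMap ℂ[X] (RatFunc ℂ) q ≠ 0 := RatFunc.algebraMap_ne_zero hq
  have hr : algebraMap ℂ[X] (RatFunc ℂ) n / algebraMap ℂ[X] (RatFunc ℂ) d = r :=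
    RatFunc.num_div_denom r
  have key : (derivative n * d - n * derivative d + C κ * n * d) * q ^ 2 = ρ * d ^ 2 := by
    apply RatFunc.algebraMap_injective ℂ
    rw [← hr, ratDeriv_div _ _ hd0, ← RatFunc.algebraMap_C] at h
    field_simp at h
    simp only [map_mul, map_add, map_sub, map_pow]
    linear_combination h
  have hdvd : d ∣ q := by
    -- If `d` vanished at `w` to higher order `k + 1` than `q`, the derivative term would have a
    -- pole of order `k + 2` there, too high for `q²` to cancel.
    refine dvd_of_rootMultiplicity_le hd0 hq fun w => ?_
    by_contra! hlt
    obtain ⟨d', hd', hdw⟩ := exists_eq_pow_rootMultiplicity_mul_and_not_dvd d hd0 w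
    obtain ⟨q', hq', hqw⟩ := exists_eq_pow_rootMultiplicity_mul_and_not_dvd q hq w
    obtain ⟨k, hk⟩ : ∃ k, d.rootMultiplicity w = k + 1 := Nat.exists_eq_succ_of_ne_zero (by omega)
    have hnw : ¬ (X - C w) ∣ n := by
      intro hX
      have h1 : (X - C w) ∣ d := (dvd_pow_self _ (by omega)).trans (pow_rootMultiplicity_dvd d w)
      exact not_isUnit_X_sub_C w (r.isCoprime_num_denom.isUnit_of_dvd' hX h1)
    have hprime := prime_X_sub_C w
    have hX0 : (X - C w) ≠ 0 := X_sub_C_ne_zero w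
    have hder : derivative d = (X - C w) ^ k * (C ((k : ℂ) + 1) * d' + (X - C w) * derivative d') := by
      conv_lhs => rw [hd', hk, derivative_mul, derivative_X_sub_C_pow, Nat.add_sub_cancel]
      push_cast
      ring
    -- Characteristic zero enters here: differentiation lowers the multiplicity by exactly one
    -- because `k + 1 ≠ 0`.
    have hk2 : ¬ (X - C w) ∣ C ((k : ℂ) + 1) * d' := by
      intro h1
      rcases hprime.dvd_or_dvd h1 with h2 | h2
      · rw [dvd_iff_isRoot, IsRoot.def, eval_C] at h2
        exact absurd h2 (by exact_mod_cast Nat.succ_ne_zero k)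
      · exact hdw h2
    rw [hk] at hd'
    rw [hder] at key
    rw [hq', hd'] at key
    exact false_of_wronskian_mul_sq_eq hprime (hs w) (hk ▸ hlt) hnw hk2 hqw key
  obtain ⟨c, hc⟩ := hdvd
  refine ⟨n * c, ?_⟩
  have hC : algebraMap ℂ[X] (RatFunc ℂ) c ≠ 0 :=
    RatFunc.algebraMap_ne_zero (by rintro rfl; exact hq (by rw [hc, mul_zero]))
  rw [hc, map_mul, map_mul, mul_div_mul_right _ _ hC, hr]

/-! ### Nondegeneracy conditions for polynomials -/

theorem zerosAndPoles_algebraMap (p : ℂ[X]) :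
    zerosAndPoles (algebraMap ℂ[X] (RatFunc ℂ) p) = {w | p.IsRoot w} := by
  ext w
  simp [zerosAndPoles, RatFunc.num_algebraMap, RatFunc.denom_algebraMap]

theorem hNondegConditions_algebraMap_iff {ι : Type*} (a : ι → ι → ℤ) (Λ y : ι → ℂ[X]) :
    HNondegConditions a (fun i => algebraMap ℂ[X] (RatFunc ℂ) (Λ i))
      (fun i => algebraMap ℂ[X] (RatFunc ℂ) (y i)) ↔
    (∀ i, y i ≠ 0) ∧ (∀ i w, (y i).rootMultiplicity w ≤ 1) ∧
      (∀ i w, (Λ i).IsRoot w → ¬ (y i).IsRoot w) ∧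
      ∀ i j, i ≠ j → a i j ≠ 0 → ∀ w, (y i).IsRoot w → ¬ (y j).IsRoot w := by
  constructor
  · rintro ⟨h1, h2, h3, h4⟩
    simp only [zerosAndPoles_algebraMap, RatFunc.num_algebraMap, Set.disjoint_left,
      Set.mem_ofPred_eq] at h2 h3 h4
    exact ⟨fun i hi => h1 i (by rw [hi, map_zero]), fun i w => (h2 i w).1, h3, h4⟩
  · rintro ⟨h1, h2, h3, h4⟩
    refine ⟨fun i => RatFunc.algebraMap_ne_zero (h1 i), ?_, ?_, ?_⟩
    · intro i w
      simp only [RatFunc.num_algebraMap, RatFunc.denom_algebraMap]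
      exact ⟨h2 i w, by rw [← C_1, rootMultiplicity_C]; exact zero_le_one⟩
    · simpa only [zerosAndPoles_algebraMap, RatFunc.num_algebraMap, Set.mem_ofPred_eq] using h3
    · simpa only [zerosAndPoles_algebraMap, Set.disjoint_left, Set.mem_ofPred_eq] using h4

/-! ### Fundamental representations -/

section Rep

variable {ι : Type*} [Fintype ι] [DecidableEq ι]
  {L : Type*} [LieRing L] [LieAlgebra ℂ L] {H : LieSubalgebra ℂ L}
  (c : LieAlgebra.Basis ι H)

/-- For `i ≠ j` the vector `e_i` is killed by `f_j`, hence is primitive for the reversed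
`sl₂`-triple of `j`. Its weight there is a natural number, `L` being finite-dimensional. This
justifies the exponents `toNat` in the `qq`-system. -/
theorem cartanMatrix_nonpos [FiniteDimensional ℂ L] {i j : ι} (hij : i ≠ j) : c.A i j ≤ 0 := by
  have P : (c.sl2 j).symm.HasPrimitiveVectorWith (c.e i) (-(c.A i j : ℂ)) :=
    { ne_zero := (c.sl2 i).e_ne_zero
      lie_h := by rw [neg_lie, c.lie_h_e, neg_smul, Int.cast_smul_eq_zsmul]
      lie_e := by rw [← lie_skew, c.lie_e_f_ne i j hij, neg_zero] }
  obtain ⟨n, hn⟩ := P.exists_nat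
  have : -(c.A i j) = (n : ℤ) := by exact_mod_cast hn
  omega

theorem cartanMatrix_det_ne_zero : c.A.det ≠ 0 := c.nondegen.det_ne_zero

/-- An element of the Cartan subalgebra on which all the simple roots take the value `1`. -/
theorem exists_grading : ∃ r : ι → ℂ, ∀ i, ∑ j, (c.A i j : ℂ) * r j = 1 := by
  have hdet : (c.A.map (Int.cast : ℤ → ℂ)).det ≠ 0 := by
    have := (Int.castRingHom ℂ).map_det c.A
    rw [RingHom.mapMatrix_apply] at this
    change (c.A.map (Int.castRingHom ℂ)).det ≠ 0
    rw [← this]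
    simpa using cartanMatrix_det_ne_zero c
  refine ⟨(c.A.map (Int.cast : ℤ → ℂ))⁻¹.mulVec 1, fun i => ?_⟩
  have h := congrFun (Matrix.mulVec_mulVec (1 : ι → ℂ) (c.A.map (Int.cast : ℤ → ℂ))
    (c.A.map (Int.cast : ℤ → ℂ))⁻¹) i
  rw [Matrix.mul_nonsing_inv _ (isUnit_iff_ne_zero.2 hdet), Matrix.one_mulVec] at h
  simpa [Matrix.mulVec, dotProduct] using h

variable {M : Type*} [AddCommGroup M] [Module ℂ M] [LieRingModule L M] [LieModule ℂ L M]

/-- The vector `f_{j₁} ⋯ f_{jₙ} ν`. -/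
def lowered (ν : M) (l : List ι) : M := l.foldr (fun j v => ⁅c.f j, v⁆) ν

@[simp] theorem lowered_nil (ν : M) : lowered c ν [] = ν := rfl

@[simp] theorem lowered_cons (ν : M) (j : ι) (l : List ι) :
    lowered c ν (j :: l) = ⁅c.f j, lowered c ν l⁆ := rfl

theorem lie_h_lie_f (k j : ι) (v : M) :
    ⁅c.h k, ⁅c.f j, v⁆⁆ = ⁅c.f j, ⁅c.h k, v⁆⁆ - (c.A j k : ℂ) • ⁅c.f j, v⁆ := by
  rw [leibniz_lie, c.lie_h_f, ← Int.cast_smul_eq_zsmul ℂ, smul_lie]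
  push_cast
  rw [neg_smul]
  abel

theorem lie_e_lie_f (k j : ι) (v : M) :
    ⁅c.e k, ⁅c.f j, v⁆⁆ = ⁅c.f j, ⁅c.e k, v⁆⁆ + if k = j then ⁅c.h k, v⁆ else 0 := by
  rw [leibniz_lie]
  split_ifs with h
  · subst h
    rw [(c.sl2 k).lie_e_f, add_comm]
  · rw [c.lie_e_f_ne k j h, zero_lie, zero_add, add_zero]

variable {c} {i : ι} {ν : M} (hν : IsFundamentalRep c i M ν)
include hν

namespace IsFundamentalRep

theorem lie_h_lowered (k : ι) (l : List ι) :
    ⁅c.h k, lowered c ν l⁆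
      = ((((if k = i then 1 else 0) - (l.map fun j => c.A j k).sum : ℤ)) : ℂ) • lowered c ν l := by
  induction l with
  | nil =>
    rw [lowered_nil, hν.weight]
    split_ifs <;> simp
  | cons j l ih =>
    rw [lowered_cons, lie_h_lie_f, ih, lie_smul, ← sub_smul]
    congr 1
    simp only [List.map_cons, List.sum_cons]
    push_cast
    ring

theorem lie_e_lowered_mem (k : ι) (l : List ι) :
    ⁅c.e k, lowered c ν l⁆ ∈ Submodule.span ℂ (Set.range (lowered c ν)) := by
  induction l with
  | nil => rw [lowered_nil, hν.raise]; exact zero_mem _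
  | cons j l ih =>
    rw [lowered_cons, lie_e_lie_f]
    refine add_mem ?_ ?_
    · have : ∀ x ∈ Submodule.span ℂ (Set.range (lowered c ν)),
          ⁅c.f j, x⁆ ∈ Submodule.span ℂ (Set.range (lowered c ν)) := by
        intro x hx
        induction hx using Submodule.span_induction with
        | mem x hx =>
          obtain ⟨l, rfl⟩ := hx
          exact Submodule.subset_span ⟨j :: l, rfl⟩
        | zero => simp
        | add x y _ _ hx hy => rw [lie_add]; exact add_mem hx hy
        | smul a x _ hx => rw [lie_smul]; exact Submodule.smul_mem _ _ hx
      exact this _ ih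
    · split_ifs
      · rw [hν.lie_h_lowered]
        exact Submodule.smul_mem _ _ (Submodule.subset_span ⟨l, rfl⟩)
      · exact zero_mem _

/-- The span is stable under the `f_j` by construction, and under the `e_k` because moving `e_k`
past `f_j` costs only a multiple of `α̌_k`, which acts on words by scalars. It is therefore a
nonzero submodule of an irreducible module. -/
theorem span_lowered : Submodule.span ℂ (Set.range (lowered c ν)) = ⊤ := by
  set S := Submodule.span ℂ (Set.range (lowered c ν)) with hS
  have hgen : ∀ x ∈ Set.range c.e ∪ Set.range c.f, ∀ v ∈ S, ⁅x, v⁆ ∈ S := by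
    intro x hx v hv
    induction hv using Submodule.span_induction with
    | mem v hv =>
      obtain ⟨l, rfl⟩ := hv
      rcases hx with ⟨k, rfl⟩ | ⟨k, rfl⟩
      · exact hν.lie_e_lowered_mem k l
      · exact Submodule.subset_span ⟨k :: l, rfl⟩
    | zero => simp
    | add x y _ _ hx hy => rw [lie_add]; exact add_mem hx hy
    | smul a x _ hx => rw [lie_smul]; exact Submodule.smul_mem _ _ hx
  -- The elements preserving `S` form a Lie subalgebra, and the `e_i`, `f_i` generate `L`.
  have hall : ∀ x : L, ∀ v ∈ S, ⁅x, v⁆ ∈ S := by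
    intro x
    have hx : x ∈ LieSubalgebra.lieSpan ℂ L (Set.range c.e ∪ Set.range c.f) := by
      rw [c.span_ef]; trivial
    induction hx using LieSubalgebra.lieSpan_induction with
    | mem x hx => exact hgen x hx
    | zero => intro v _; simp
    | add x y _ _ hx hy => intro v hv; rw [add_lie]; exact add_mem (hx v hv) (hy v hv)
    | smul a x _ hx => intro v hv; rw [smul_lie]; exact Submodule.smul_mem _ _ (hx v hv)
    | lie x y _ _ hx hy =>
      intro v hv
      rw [lie_lie]
      exact sub_mem (hx _ (hy v hv)) (hy _ (hx v hv))
  let N : LieSubmodule ℂ L M := { S with lie_mem := fun {x v} hv => hall x v hv }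
  have hN : N = ⊤ := by
    have := hν.irreducible
    refine (eq_bot_or_eq_top N).resolve_left fun h => hν.ne_zero ?_
    have : ν ∈ N := Submodule.subset_span ⟨[], rfl⟩
    rw [h] at this
    simpa using this
  have := congrArg LieSubmodule.toSubmodule hN
  simpa [N] using this

/-- All simple roots equal `1` on the grading element, so each `f_j` lowers its eigenvalue by one
and the length of a word can be read off. -/
theorem lie_grading_lowered {r : ι → ℂ} (hr : ∀ i, ∑ j, (c.A i j : ℂ) * r j = 1) (l : List ι) :
    ⁅∑ k, r k • c.h k, lowered c ν l⁆ = (r i - l.length) • lowered c ν l := by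
  have hw : ∀ l : List ι, ∑ k, r k * (((l.map fun j => c.A j k).sum : ℤ) : ℂ) = l.length := by
    intro l
    induction l with
    | nil => simp
    | cons j l ih =>
      simp only [List.map_cons, List.sum_cons, Int.cast_add, mul_add, Finset.sum_add_distrib, ih,
        List.length_cons, Nat.cast_add, Nat.cast_one]
      rw [← hr j, add_comm]
      simp only [mul_comm]
  rw [sum_lie]
  simp only [smul_lie, hν.lie_h_lowered, smul_smul]
  rw [← Finset.sum_smul, ← hw l]
  simp [mul_sub, Finset.sum_sub_distrib]

/-- The highest weight functional. -/
theorem exists_highestWeightFunctional :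
    ∃ φ : M →ₗ[ℂ] ℂ, φ ν = 1 ∧ (∀ j x, φ ⁅c.f j, x⁆ = 0) ∧
      ∀ j x, φ ⁅c.h j, x⁆ = if j = i then φ x else 0 := by
  obtain ⟨r, hr⟩ := exists_grading c
  set D : Module.End ℂ M := LieModule.toEnd ℂ L M (∑ k, r k • c.h k) with hD
  set U := Submodule.span ℂ (Set.range fun p : ι × List ι => lowered c ν (p.1 :: p.2)) with hU
  -- Nonempty words have eigenvalue `r i - n` with `n ≥ 1`, so `U` avoids the eigenspace containing
  -- `ν`.
  have hUle : U ≤ ⨆ μ ≠ r i, D.eigenspace μ := by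
    rw [hU, Submodule.span_le]
    rintro _ ⟨⟨j, l⟩, rfl⟩
    refine Submodule.mem_iSup_of_mem (r i - (j :: l).length)
      (Submodule.mem_iSup_of_mem ?_ ?_)
    · simpa [sub_eq_self] using Nat.cast_add_one_ne_zero l.length
    · rw [Module.End.mem_eigenspace_iff, hD, LieModule.toEnd_apply_apply]
      exact hν.lie_grading_lowered hr (j :: l)
  have hνU : ν ∉ U := by
    intro h
    have h1 : ν ∈ D.eigenspace (r i) := by
      rw [Module.End.mem_eigenspace_iff, hD, LieModule.toEnd_apply_apply]
      simpa using hν.lie_grading_lowered hr []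
    exact hν.ne_zero (Submodule.disjoint_def.1 (D.eigenspaces_iSupIndep (r i)) ν h1 (hUle h))
  -- Any functional killing `U` but not `ν` will do after rescaling, because `U` contains the image
  -- of every `f_j`.
  obtain ⟨φ, hφ, hφU⟩ := Submodule.exists_le_ker_of_notMem hνU
  have hf : ∀ j x, φ ⁅c.f j, x⁆ = 0 := by
    intro j x
    have hx : x ∈ Submodule.span ℂ (Set.range (lowered c ν)) := by rw [hν.span_lowered]; trivial
    induction hx using Submodule.span_induction with
    | mem x hx =>
      obtain ⟨l, rfl⟩ := hx
      exact hφU (Submodule.subset_span ⟨(j, l), rfl⟩)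
    | zero => simp
    | add x y _ _ hx hy => rw [lie_add, map_add, hx, hy, add_zero]
    | smul a x _ hx => rw [lie_smul, map_smul, hx, smul_zero]
  have hh : ∀ j x, φ ⁅c.h j, x⁆ = if j = i then φ x else 0 := by
    intro j x
    have hx : x ∈ Submodule.span ℂ (Set.range (lowered c ν)) := by rw [hν.span_lowered]; trivial
    induction hx using Submodule.span_induction with
    | mem x hx =>
      obtain ⟨l, rfl⟩ := hx
      cases l with
      | nil => rw [lowered_nil, hν.weight]; split_ifs <;> simp
      | cons k l => rw [hν.lie_h_lowered, map_smul, lowered_cons, hf]; simp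
    | zero => simp
    | add x y _ _ hx hy => rw [lie_add, map_add, hx, hy]; split_ifs <;> simp
    | smul a x _ hx => rw [lie_smul, map_smul, hx]; split_ifs <;> simp
  refine ⟨(φ ν)⁻¹ • φ, ?_, ?_, ?_⟩
  · simp [inv_mul_cancel₀ hφ]
  · intro j x; simp [hf]
  · intro j x; simp [hh]

/-- Any element of `L` shifting the eigenvalues of the grading by a nonzero amount acts
nilpotently. -/
theorem isNilpotent_toEnd {r : ι → ℂ} (hr : ∀ i, ∑ j, (c.A i j : ℂ) * r j = 1) {x : L} {a : ℂ}
    (ha : a ≠ 0) (hx : ⁅∑ k, r k • c.h k, x⁆ = a • x) : IsNilpotent (LieModule.toEnd ℂ L M x) := by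
  have := hν.finiteDimensional
  set E := LieModule.toEnd ℂ L M x with hE
  set D : Module.End ℂ M := LieModule.toEnd ℂ L M (∑ k, r k • c.h k) with hD
  have hshift : ∀ (μ : ℂ) (v : M), D v = μ • v → ∀ n : ℕ, D ((E ^ n) v) = (μ + n * a) • (E ^ n) v := by
    intro μ v hv n
    induction n with
    | zero => simpa using hv
    | succ n ih =>
      rw [pow_succ', Module.End.mul_apply]
      simp only [hD, hE, LieModule.toEnd_apply_apply] at ih ⊢
      rw [leibniz_lie, hx, ih, smul_lie, lie_smul, ← add_smul]
      congr 1
      push_cast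
      ring
  have hzero : ∀ (μ : ℂ) (v : M), D v = μ • v → ∃ n : ℕ, (E ^ n) v = 0 := by
    intro μ v hv
    by_contra! hne
    -- If no power of `E` killed `v`, the vectors `E ^ n v` would be eigenvectors of `D` for
    -- infinitely many distinct eigenvalues.
    have hfin : {z : ℂ | D.HasEigenvalue z}.Finite := D.finite_hasEigenvalue
    refine Set.infinite_of_injective_forall_mem (f := fun n : ℕ => μ + n * a) ?_ ?_ hfin
    · intro m n hmn
      simpa [ha] using hmn
    · intro n
      exact Module.End.hasEigenvalue_of_hasEigenvector
        ⟨Module.End.mem_eigenspace_iff.2 (hshift μ v hv n), hne n⟩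
  rw [Module.End.isNilpotent_iff_of_finite]
  intro v
  have hv : v ∈ Submodule.span ℂ (Set.range (lowered c ν)) := by rw [hν.span_lowered]; trivial
  induction hv using Submodule.span_induction with
  | mem v hv =>
    obtain ⟨l, rfl⟩ := hv
    exact hzero _ _ (hν.lie_grading_lowered hr l)
  | zero => exact ⟨0, by simp⟩
  | add v w _ _ hv hw =>
    obtain ⟨m, hm⟩ := hv
    obtain ⟨n, hn⟩ := hw
    refine ⟨m + n, ?_⟩
    rw [map_add, pow_add, Module.End.mul_apply _ _ w, hn, map_zero, add_zero,
      (Commute.refl E).pow_pow m n |>.eq, Module.End.mul_apply, hm, map_zero]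
  | smul a v _ hv =>
    obtain ⟨m, hm⟩ := hv
    exact ⟨m, by rw [map_smul, hm, smul_zero]⟩

theorem isNilpotent_toEnd_e (j : ι) : IsNilpotent (LieModule.toEnd ℂ L M (c.e j)) := by
  obtain ⟨r, hr⟩ := exists_grading c
  refine hν.isNilpotent_toEnd hr one_ne_zero ?_
  rw [sum_lie]
  simp only [smul_lie, c.lie_h_e, ← Int.cast_smul_eq_zsmul ℂ, smul_smul]
  rw [← Finset.sum_smul, ← hr j]
  simp only [mul_comm]

/-- A basis of weight vectors, with integral weights. -/
theorem exists_weightBasis : ∃ (s : Set M) (b : Module.Basis s ℂ M) (m : s → ι → ℤ),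
    ∀ k j, ⁅c.h j, b k⁆ = (m k j : ℂ) • b k := by
  have hs : ⊤ ≤ Submodule.span ℂ (Set.range (lowered c ν)) := hν.span_lowered.ge
  have h : ∀ k, ∃ m : ι → ℤ, ∀ j,
      ⁅c.h j, Module.Basis.ofSpan hs k⁆ = (m j : ℂ) • Module.Basis.ofSpan hs k := by
    intro k
    -- The basis is extracted from the spanning family of words, so each basis vector is itself a
    -- word and has integral weights.
    obtain ⟨l, hl⟩ := Module.Basis.ofSpan_subset hs ⟨k, rfl⟩
    rw [← hl]
    exact ⟨_, fun j => hν.lie_h_lowered j l⟩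
  choose m hm using h
  exact ⟨_, Module.Basis.ofSpan hs, m, hm⟩

theorem lie_h_lie_f_self (j : ι) :
    ⁅c.h j, ⁅c.f i, ν⁆⁆ = ((((if j = i then 1 else 0) - c.A i j : ℤ)) : ℂ) • ⁅c.f i, ν⁆ := by
  simpa using hν.lie_h_lowered j [i]

theorem lie_e_lie_f_self (j : ι) : ⁅c.e j, ⁅c.f i, ν⁆⁆ = if j = i then ν else 0 := by
  rw [lie_e_lie_f, hν.raise, lie_zero, zero_add, hν.weight]
  split_ifs <;> simp

end IsFundamentalRep

end Rep

/-! ### Elements of the group and their action on the planes `W_i` -/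

section GroupElements

variable {ι : Type*} [Fintype ι] [DecidableEq ι]
  {L : Type*} [LieRing L] [LieAlgebra ℂ L] {H : LieSubalgebra ℂ L}
  {c : LieAlgebra.Basis ι H}
  {V : ι → Type*} [∀ i, AddCommGroup (V i)] [∀ i, Module ℂ (V i)]
  [∀ i, LieRingModule L (V i)] [∀ i, LieModule ℂ L (V i)]

theorem scaledAction_tmul {M : Type*} [AddCommGroup M] [Module ℂ M] [LieRingModule L M]
    [LieModule ℂ L M] (x : L) (t a : RatFunc ℂ) (m : M) :
    scaledAction M x t (a ⊗ₜ m) = (t * a) ⊗ₜ ⁅x, m⁆ := rfl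

theorem scaledAction_eq_smul {M : Type*} [AddCommGroup M] [Module ℂ M] [LieRingModule L M]
    [LieModule ℂ L M] (x : L) (t : RatFunc ℂ) :
    scaledAction M x t = t • (LieModule.toEnd ℂ L M x).baseChange (RatFunc ℂ) := by
  rw [← LieModule.toEnd_baseChange, ← map_smul, TensorProduct.smul_tmul', smul_eq_mul, mul_one]
  rfl

theorem isNilpotent_scaledAction {M : Type*} [AddCommGroup M] [Module ℂ M] [LieRingModule L M]
    [LieModule ℂ L M] {x : L} (hx : IsNilpotent (LieModule.toEnd ℂ L M x)) (t : RatFunc ℂ) :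
    IsNilpotent (scaledAction M x t) := by
  obtain ⟨n, hn⟩ := hx
  refine ⟨n, ?_⟩
  rw [scaledAction_eq_smul, _root_.smul_pow, ← LinearMap.baseChange_pow, hn, LinearMap.baseChange_zero,
    smul_zero]

theorem exists_isExp {x : L} (hx : ∀ j, IsNilpotent (LieModule.toEnd ℂ L (V j) x))
    (t : RatFunc ℂ) : ∃ g : Ambient V, IsExp x t g := by
  have hX := fun j => isNilpotent_scaledAction (hx j) t
  refine ⟨fun j => LinearEquiv.ofLinearMap (IsNilpotent.exp (scaledAction (V j) x t))
    (IsNilpotent.exp (-scaledAction (V j) x t))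
    (IsNilpotent.exp_mul_exp_neg_self (hX j)) (IsNilpotent.exp_neg_mul_exp_self (hX j)),
    fun j => ?_⟩
  obtain ⟨n, hn⟩ := hX j
  refine ⟨n, hn, fun w => ?_⟩
  change IsNilpotent.exp (scaledAction (V j) x t) w = _
  rw [IsNilpotent.exp_eq_sum hn, LinearMap.sum_apply]
  refine Finset.sum_congr rfl fun k _ => ?_
  rw [LinearMap.smul_apply]
  exact inv_natCast_smul_eq ℚ (RatFunc ℂ) k.factorial ((scaledAction (V j) x t ^ k) w)

theorem IsExp.apply_of_sq_eq_zero {x : L} {t : RatFunc ℂ} {g : Ambient V} (hg : IsExp x t g) {j : ι}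
    {w : RatFunc ℂ ⊗[ℂ] V j} (hw : scaledAction (V j) x t (scaledAction (V j) x t w) = 0) :
    g j w = w + scaledAction (V j) x t w := by
  obtain ⟨N, hN, h⟩ := hg j
  have h2 : ∀ n, ((scaledAction (V j) x t) ^ (n + 2)) w = 0 := by
    intro n
    rw [pow_add, Module.End.mul_apply, sq, Module.End.mul_apply, hw, map_zero]
  -- `N` may be less than `2`; two zero terms are appended so that the terms `n = 0, 1` can be split
  -- off in every case.
  have h3 : ∑ n ∈ Finset.range (N + 2), ((n.factorial : RatFunc ℂ)⁻¹) •
      (scaledAction (V j) x t ^ n) w = ∑ n ∈ Finset.range N, ((n.factorial : RatFunc ℂ)⁻¹) •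
      (scaledAction (V j) x t ^ n) w := by
    rw [Finset.sum_range_succ, Finset.sum_range_succ, pow_add _ N 1, hN]
    simp
  rw [h, ← h3, Finset.sum_range_succ', Finset.sum_range_succ',
    Finset.sum_eq_zero fun n _ => by rw [h2, smul_zero]]
  simp [add_comm]

/-- The map is defined diagonally on a basis of weight vectors. The condition concerns all weight
vectors, not only those of the basis, so it must be checked that such a vector involves only basis
vectors of its own weight. -/
theorem exists_isCocharacter {ν : ∀ i, V i} (hν : ∀ i, IsFundamentalRep c i (V i) (ν i)) (i : ι)
    (t : (RatFunc ℂ)ˣ) : ∃ g : Ambient V, IsCocharacter c i t g := by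
  have : ∀ j, ∃ g : (RatFunc ℂ ⊗[ℂ] V j) ≃ₗ[RatFunc ℂ] (RatFunc ℂ ⊗[ℂ] V j),
      ∀ (n : ℤ) (x : V j), ⁅c.h i, x⁆ = (n : ℂ) • x →
        g (1 ⊗ₜ[ℂ] x) = ((t ^ n : (RatFunc ℂ)ˣ) : RatFunc ℂ) ⊗ₜ[ℂ] x := by
    intro j
    obtain ⟨s, b, m, hm⟩ := (hν j).exists_weightBasis
    let B := b.baseChange (RatFunc ℂ)
    let g := B.equiv (B.unitsSMul fun k => t ^ m k i) (Equiv.refl s)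
    have hg : ∀ k, g (1 ⊗ₜ b k) = ((t ^ m k i : (RatFunc ℂ)ˣ) : RatFunc ℂ) ⊗ₜ b k := by
      intro k
      rw [← Module.Basis.baseChange_apply, Module.Basis.equiv_apply, Equiv.refl_apply,
        Module.Basis.unitsSMul_apply, Module.Basis.baseChange_apply, Units.smul_def,
        TensorProduct.smul_tmul', smul_eq_mul, mul_one]
    refine ⟨g, fun n x hx => ?_⟩
    -- Compare the `k`-th coordinates of the two sides of `hx`.
    have hrepr : ∀ k, b.repr x k ≠ 0 → m k i = n := by
      intro k hk
      have h1 : ∀ y, b.repr ⁅c.h i, y⁆ k = (m k i : ℂ) * b.repr y k := by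
        have h2 : b.coord k ∘ₗ LieModule.toEnd ℂ L (V j) (c.h i) = (m k i : ℂ) • b.coord k := by
          refine b.ext fun l => ?_
          rw [LinearMap.comp_apply, LieModule.toEnd_apply_apply, hm, map_smul, LinearMap.smul_apply,
            Module.Basis.coord_apply, Module.Basis.repr_self]
          by_cases hl : l = k
          · rw [hl]
          · rw [Finsupp.single_eq_of_ne' hl, smul_zero, smul_zero]
        exact fun y => LinearMap.congr_fun h2 y
      have h2 := h1 x
      rw [hx, map_smul, Finsupp.smul_apply, smul_eq_mul] at h2
      exact_mod_cast (mul_right_cancel₀ hk h2).symm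
    rw [← b.linearCombination_repr x, Finsupp.linearCombination_apply, Finsupp.sum,
      TensorProduct.tmul_sum, TensorProduct.tmul_sum, map_sum]
    refine Finset.sum_congr rfl fun k hk => ?_
    rw [← hrepr k (Finsupp.mem_support_iff.1 hk), TensorProduct.tmul_smul, TensorProduct.tmul_smul,
      ← hg, ← IsScalarTower.algebraMap_smul (RatFunc ℂ), map_smul,
      IsScalarTower.algebraMap_smul]
  choose g hg using this
  exact ⟨g, hg⟩

variable (c) in
/-- The factor `t_j ∏_k t_k ^ (-⟨α_j, α̌_k⟩)` by which `∏_k t_k ^ α̌_k` acts on `f_j ν_{ω_j}`. -/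
noncomputable def loweredFactor (t : ι → (RatFunc ℂ)ˣ) (j : ι) : (RatFunc ℂ)ˣ := t j * ∏ k, t k ^ (-c.A j k)

theorem loweredFactor_mul (t t' : ι → (RatFunc ℂ)ˣ) (j : ι) :
    loweredFactor c (t * t') j = loweredFactor c t j * loweredFactor c t' j := by
  simp only [loweredFactor, Pi.mul_apply, mul_zpow, Finset.prod_mul_distrib]
  exact mul_mul_mul_comm _ _ _ _

theorem loweredFactor_one (j : ι) : loweredFactor c 1 j = 1 := by
  simp [loweredFactor]

theorem loweredFactor_mulSingle (i : ι) (t : (RatFunc ℂ)ˣ) (j : ι) :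
    loweredFactor c (Pi.mulSingle i t) j = t ^ ((if i = j then 1 else 0) - c.A j i) := by
  rw [loweredFactor, Finset.prod_eq_single i]
  · rw [Pi.mulSingle_eq_same, sub_eq_add_neg, zpow_add]
    congr 1
    split_ifs with h
    · subst h; simp
    · rw [Pi.mulSingle_eq_of_ne (Ne.symm h), zpow_zero]
  · intro k _ hk
    rw [Pi.mulSingle_eq_of_ne hk, one_zpow]
  · simp

variable (c) in
/-- In the basis `ν_{ω_j}, f_j ν_{ω_j}` of `W_j`, the matrix of `g` is upper triangular, with diagonal
entries `t_j`, `t_j ∏_k t_k ^ (-⟨α_j, α̌_k⟩)` and off-diagonal entry `s_j`. -/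
def ActsOnPlanes (ν : ∀ i, V i) (g : Ambient V) (t : ι → (RatFunc ℂ)ˣ) (s : ι → RatFunc ℂ) : Prop :=
  ∀ j, g j (1 ⊗ₜ ν j) = (t j : RatFunc ℂ) ⊗ₜ ν j ∧
    g j (1 ⊗ₜ ⁅c.f j, ν j⁆)
      = (loweredFactor c t j : RatFunc ℂ) ⊗ₜ ⁅c.f j, ν j⁆ + s j ⊗ₜ ν j

theorem apply_tmul (g : Ambient V) (j : ι) (a : RatFunc ℂ) (v : V j) :
    g j (a ⊗ₜ v) = a • g j (1 ⊗ₜ v) := by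
  rw [← map_smul, TensorProduct.smul_tmul', smul_eq_mul, mul_one]

variable {ν : ∀ i, V i}

theorem ActsOnPlanes.one : ActsOnPlanes c ν (1 : Ambient V) 1 0 := by
  intro j
  rw [loweredFactor_one]
  simp

theorem ActsOnPlanes.mul {g g' : Ambient V} {t t' : ι → (RatFunc ℂ)ˣ} {s s' : ι → RatFunc ℂ}
    (h : ActsOnPlanes c ν g t s) (h' : ActsOnPlanes c ν g' t' s') :
    ActsOnPlanes c ν (g * g') (t * t')
      (fun j => (loweredFactor c t' j : RatFunc ℂ) * s j + s' j * (t j : RatFunc ℂ)) := by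
  intro j
  constructor
  · change g j (g' j _) = _
    rw [(h' j).1, apply_tmul, (h j).1, TensorProduct.smul_tmul', smul_eq_mul, mul_comm]
    rfl
  · change g j (g' j _) = _
    rw [(h' j).2, map_add, apply_tmul, (h j).2, apply_tmul _ _ (s' j), (h j).1, smul_add,
      loweredFactor_mul]
    simp only [TensorProduct.smul_tmul', smul_eq_mul, TensorProduct.add_tmul, Units.val_mul]
    rw [mul_comm, add_assoc]

theorem ActsOnPlanes.inv {g : Ambient V} {t : ι → (RatFunc ℂ)ˣ} {s : ι → RatFunc ℂ}
    (h : ActsOnPlanes c ν g t s) : ∃ s', ActsOnPlanes c ν g⁻¹ t⁻¹ s' := by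
  have hinv : ∀ j, loweredFactor c t⁻¹ j = (loweredFactor c t j)⁻¹ := by
    intro j
    rw [eq_inv_iff_mul_eq_one, ← loweredFactor_mul, inv_mul_cancel, loweredFactor_one]
  refine ⟨fun j => -((loweredFactor c t j)⁻¹ : (RatFunc ℂ)ˣ) * s j * ((t j)⁻¹ : (RatFunc ℂ)ˣ),
    fun j => ⟨?_, ?_⟩⟩
  · change (g j).symm _ = _
    rw [LinearEquiv.symm_apply_eq, apply_tmul, (h j).1, TensorProduct.smul_tmul', smul_eq_mul,
      Pi.inv_apply, Units.inv_mul]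
  · change (g j).symm _ = _
    rw [LinearEquiv.symm_apply_eq, map_add, apply_tmul, (h j).2, apply_tmul _ _ (_ * _), (h j).1,
      smul_add, hinv]
    simp only [TensorProduct.smul_tmul', smul_eq_mul, Units.inv_mul, neg_mul]
    rw [mul_assoc _ _ (t j : RatFunc ℂ), Units.inv_mul, mul_one, TensorProduct.neg_tmul,
      add_assoc, add_neg_cancel, add_zero]

variable (hν : ∀ i, IsFundamentalRep c i (V i) (ν i))
include hν

theorem IsCocharacter.actsOnPlanes {i : ι} {t : (RatFunc ℂ)ˣ} {g : Ambient V}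
    (hg : IsCocharacter c i t g) : ActsOnPlanes c ν g (Pi.mulSingle i t) 0 := by
  intro j
  constructor
  · by_cases hij : i = j
    · subst hij
      have := hg i 1 (ν i) (by rw [(hν i).weight]; simp)
      simpa using this
    · have := hg j 0 (ν j) (by rw [(hν j).weight, if_neg hij]; simp)
      rw [this, Pi.mulSingle_eq_of_ne (Ne.symm hij), zpow_zero]
  · rw [hg j _ _ ((hν j).lie_h_lie_f_self i), loweredFactor_mulSingle]
    simp

theorem IsExp.actsOnPlanes {i : ι} {t : RatFunc ℂ} {g : Ambient V}
    (hg : IsExp (c.e i) t g) : ActsOnPlanes c ν g 1 (Pi.single i t) := by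
  intro j
  constructor
  · rw [hg.apply_of_sq_eq_zero]
    · rw [scaledAction_tmul, (hν j).raise]
      simp
    · rw [scaledAction_tmul, (hν j).raise]
      simp
  · rw [hg.apply_of_sq_eq_zero]
    · rw [scaledAction_tmul, (hν j).lie_e_lie_f_self, loweredFactor_one]
      by_cases hij : i = j
      · subst hij; simp
      · simp [hij]
    · rw [scaledAction_tmul, (hν j).lie_e_lie_f_self]
      split_ifs
      · rw [scaledAction_tmul, (hν j).raise, TensorProduct.tmul_zero]
      · simp

/-- The generators act in this form, and the form survives products and inverses because the
diagonal entries are multiplicative in `t`. That one tuple `t` controls both diagonal entries on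
every plane is what produces the product over `k` in `ρ_j`. -/
theorem exists_actsOnPlanes_of_mem {g : Ambient V}
    (hg : g ∈ Subgroup.closure (torusElements c V ∪ raisingElements c V)) :
    ∃ t s, ActsOnPlanes c ν g t s := by
  induction hg using Subgroup.closure_induction with
  | mem g hg =>
    rcases hg with ⟨i, t, hg⟩ | ⟨i, t, hg⟩
    · exact ⟨_, _, hg.actsOnPlanes hν⟩
    · exact ⟨_, _, hg.actsOnPlanes hν⟩
  | one => exact ⟨_, _, ActsOnPlanes.one⟩
  | mul g h _ _ hg hh =>
    obtain ⟨t, s, hg⟩ := hg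
    obtain ⟨t', s', hh⟩ := hh
    exact ⟨_, _, hg.mul hh⟩
  | inv g _ hg =>
    obtain ⟨t, s, hg⟩ := hg
    obtain ⟨s', hs'⟩ := hg.inv
    exact ⟨_, _, hs'⟩

/-- A torus element realizes `t`. Each `exp(a e_i)` changes only the off-diagonal entry on `W_i`, so
on the planes these exponentials combine additively, whatever their order in the group. -/
theorem exists_mem_actsOnPlanes (t : ι → (RatFunc ℂ)ˣ) (s : ι → RatFunc ℂ) :
    ∃ g ∈ Subgroup.closure (torusElements c V ∪ raisingElements c V), ActsOnPlanes c ν g t s := by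
  have ht : ∀ S : Finset ι, ∃ g ∈ Subgroup.closure (torusElements c V ∪ raisingElements c V),
      ActsOnPlanes c ν g (∏ i ∈ S, Pi.mulSingle i (t i)) 0 := by
    intro S
    induction S using Finset.induction_on with
    | empty => exact ⟨1, one_mem _, ActsOnPlanes.one⟩
    | insert i S hi ih =>
      obtain ⟨g, hg, h⟩ := ih
      obtain ⟨g', hg'⟩ := exists_isCocharacter hν i (t i)
      refine ⟨g' * g, mul_mem (Subgroup.subset_closure (Or.inl ⟨i, _, hg'⟩)) hg, ?_⟩
      rw [Finset.prod_insert hi]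
      convert (hg'.actsOnPlanes hν).mul h using 1
      ext j
      simp
  -- The entries are `s i / t i` because multiplying on the left by the torus element scales them by
  -- `t i`.
  have hs : ∀ S : Finset ι, ∃ g ∈ Subgroup.closure (torusElements c V ∪ raisingElements c V),
      ActsOnPlanes c ν g 1 (∑ i ∈ S, Pi.single i (s i / t i)) := by
    intro S
    induction S using Finset.induction_on with
    | empty => exact ⟨1, one_mem _, ActsOnPlanes.one⟩
    | insert i S hi ih =>
      obtain ⟨g, hg, h⟩ := ih
      obtain ⟨g', hg'⟩ := exists_isExp (V := V) (fun j => (hν j).isNilpotent_toEnd_e i) (s i / t i)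
      refine ⟨g' * g, mul_mem (Subgroup.subset_closure (Or.inr ⟨i, _, hg'⟩)) hg, ?_⟩
      rw [Finset.sum_insert hi]
      convert (hg'.actsOnPlanes hν).mul h using 1
      · rw [one_mul]
      · ext j
        rw [loweredFactor_one]
        simp
  obtain ⟨g, hg, h⟩ := ht Finset.univ
  obtain ⟨g', hg', h'⟩ := hs Finset.univ
  rw [Finset.univ_prod_mulSingle] at h
  rw [Finset.univ_sum_single] at h'
  refine ⟨g * g', mul_mem hg hg', ?_⟩
  convert h.mul h' using 1
  · rw [mul_one]
  · ext j
    simp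

/-- The highest weight functional kills the image of every `f_i`, so it is invariant under `N₋` and
is scaled by the torus. It serves twice: to read off the coefficient of `ν_j` on `W_j`, and to
detect membership in `B₋`. -/
theorem exists_baseChange_highestWeightFunctional (j : ι) :
    ∃ φ : RatFunc ℂ ⊗[ℂ] V j →ₗ[RatFunc ℂ] RatFunc ℂ,
      (∀ a, φ (a ⊗ₜ ν j) = a) ∧ (∀ a, φ (a ⊗ₜ ⁅c.f j, ν j⁆) = 0) ∧
      ∀ g ∈ Subgroup.closure (torusElements c V ∪ loweringElements c V),
        ∃ u : (RatFunc ℂ)ˣ, ∀ w, φ (g j w) = u * φ w := by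
  obtain ⟨φ, h1, h2, h3⟩ := (hν j).exists_highestWeightFunctional
  let Φ : RatFunc ℂ ⊗[ℂ] V j →ₗ[RatFunc ℂ] RatFunc ℂ :=
    (TensorProduct.AlgebraTensorModule.rid ℂ (RatFunc ℂ) (RatFunc ℂ)).toLinearMap
      ∘ₗ φ.baseChange (RatFunc ℂ)
  have hΦ : ∀ a v, Φ (a ⊗ₜ v) = φ v • a := fun a v => rfl
  refine ⟨Φ, fun a => by rw [hΦ, h1, one_smul], fun a => by rw [hΦ, h2, zero_smul], ?_⟩
  intro g hg
  induction hg using Subgroup.closure_induction with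
  | mem g hg =>
    rcases hg with ⟨i, t, hg⟩ | ⟨i, t, hg⟩
    · refine ⟨t ^ (if i = j then 1 else 0 : ℤ), fun w => ?_⟩
      obtain ⟨s, b, m, hm⟩ := (hν j).exists_weightBasis
      have key : Φ ∘ₗ (g j).toLinearMap
          = ((t ^ (if i = j then 1 else 0 : ℤ) : (RatFunc ℂ)ˣ) : RatFunc ℂ) • Φ := by
        refine (b.baseChange (RatFunc ℂ)).ext fun k => ?_
        rw [LinearMap.comp_apply, LinearEquiv.coe_coe, LinearMap.smul_apply,
          Module.Basis.baseChange_apply, hg j _ _ (hm k i), hΦ, hΦ]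
        -- Either the functional kills `b k`, or `α̌_i` has the same eigenvalue on `b k` as on `ν
        -- j`.
        have := h3 i (b k)
        rw [hm, map_smul, smul_eq_mul] at this
        by_cases h0 : φ (b k) = 0
        · rw [h0, zero_smul, zero_smul, smul_zero]
        · have h4 : m k i = if i = j then 1 else 0 := by
            split_ifs at this ⊢
            · exact_mod_cast mul_right_cancel₀ h0 (this.trans (one_mul _).symm)
            · exact_mod_cast (mul_eq_zero.1 this).resolve_right h0
          rw [h4, smul_comm, smul_eq_mul, mul_one]
      exact LinearMap.congr_fun key w
    · refine ⟨1, fun w => ?_⟩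
      obtain ⟨N, hN, h⟩ := hg j
      have h4 : ∀ w, Φ (scaledAction (V j) (c.f i) t w) = 0 := by
        intro w
        induction w using TensorProduct.induction_on with
        | zero => simp
        | tmul a v => rw [scaledAction_tmul, hΦ, h2, zero_smul]
        | add w z hw hz => rw [map_add, map_add, hw, hz, add_zero]
      -- `N = 0` would make the identity of a nonzero space vanish; with `N ≥ 1` the term `n = 0`
      -- can be split off, and the functional kills all others.
      have hN0 : N ≠ 0 := by
        rintro rfl
        have h5 : Φ (1 ⊗ₜ ν j) = 0 := by
          have h6 : (1 : Module.End (RatFunc ℂ) (RatFunc ℂ ⊗[ℂ] V j)) (1 ⊗ₜ ν j) = 0 := by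
            rw [← pow_zero (scaledAction (V j) (c.f i) t), hN, LinearMap.zero_apply]
          rw [Module.End.one_apply] at h6
          rw [h6, map_zero]
        rw [hΦ, h1, one_smul] at h5
        exact one_ne_zero h5
      obtain ⟨n, rfl⟩ := Nat.exists_eq_succ_of_ne_zero hN0
      rw [h, map_sum, Finset.sum_range_succ']
      simp [pow_succ', h4]
  | one => exact ⟨1, fun w => by simp⟩
  | mul g h _ _ hg hh =>
    obtain ⟨u, hu⟩ := hg
    obtain ⟨v, hv⟩ := hh
    refine ⟨u * v, fun w => ?_⟩
    change Φ (g j (h j w)) = _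
    rw [hu, hv, Units.val_mul, mul_assoc]
  | inv g _ hg =>
    obtain ⟨u, hu⟩ := hg
    refine ⟨u⁻¹, fun w => ?_⟩
    have := hu ((g j).symm w)
    rw [LinearEquiv.apply_symm_apply] at this
    change Φ ((g j).symm w) = _
    rw [this, Units.inv_mul_cancel_left]

end GroupElements

/-! ### Logarithmic derivatives -/

/-- The logarithmic derivative, as a homomorphism. -/
noncomputable def logDerivHom : (RatFunc ℂ)ˣ →* Multiplicative (RatFunc ℂ) where
  toFun f := Multiplicative.ofAdd ((f : RatFunc ℂ)⁻¹ * ratDeriv (f : RatFunc ℂ))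
  map_one' := by simp [ratDeriv_one]
  map_mul' f g := by
    rw [← ofAdd_add, Units.val_mul, ratDeriv_mul]
    congr 1
    field_simp

/-- The logarithmic derivative of a nonzero rational function. -/
noncomputable def logDer (f : (RatFunc ℂ)ˣ) : RatFunc ℂ :=
  (f : RatFunc ℂ)⁻¹ * ratDeriv (f : RatFunc ℂ)

theorem toAdd_logDerivHom (f : (RatFunc ℂ)ˣ) : (logDerivHom f).toAdd = logDer f := rfl

theorem ratDeriv_eq_logDer_mul (f : (RatFunc ℂ)ˣ) :
    ratDeriv (f : RatFunc ℂ) = logDer f * (f : RatFunc ℂ) := by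
  rw [logDer]
  field_simp

/-! ### Weights on the lowered vectors and the functions `ρ_j` -/

section Connections

variable {ι : Type*} [Fintype ι] [DecidableEq ι]
  {L : Type*} [LieRing L] [LieAlgebra ℂ L] {H : LieSubalgebra ℂ L}
  {c : LieAlgebra.Basis ι H}
  {V : ι → Type*} [∀ i, AddCommGroup (V i)] [∀ i, Module ℂ (V i)]
  [∀ i, LieRingModule L (V i)] [∀ i, LieModule ℂ L (V i)]

variable (c) in
/-- The eigenvalue of `∑ u_k α̌_k` on `f_j ν_{ω_j}`. -/
noncomputable def loweredWeight (u : ι → RatFunc ℂ) (j : ι) : RatFunc ℂ :=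
  u j - ∑ k, (c.A j k : RatFunc ℂ) * u k

theorem loweredWeight_sub (u v : ι → RatFunc ℂ) (j : ι) :
    loweredWeight c (u - v) j = loweredWeight c u j - loweredWeight c v j := by
  simp only [loweredWeight, Pi.sub_apply, mul_sub, Finset.sum_sub_distrib]
  ring

theorem loweredWeight_C (ζ : ι → ℂ) (j : ι) :
    loweredWeight c (fun k => RatFunc.C (ζ k)) j = RatFunc.C (ζ j) - RatFunc.C (rootPairing c ζ j) := by
  simp [loweredWeight, rootPairing, cartan]

theorem logDer_loweredFactor (t : ι → (RatFunc ℂ)ˣ) (j : ι) :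
    logDer (loweredFactor c t j) = loweredWeight c (fun k => logDer (t k)) j := by
  rw [← toAdd_logDerivHom, loweredFactor, map_mul, map_prod, toAdd_mul, toAdd_prod]
  simp only [map_zpow, toAdd_zpow, toAdd_logDerivHom, loweredWeight, sub_eq_add_neg,
    ← Finset.sum_neg_distrib, zsmul_eq_mul, Int.cast_neg, neg_mul]

theorem eq_zero_of_sum_cartanMatrix_mul_eq_zero {x : ι → RatFunc ℂ}
    (hx : ∀ j, ∑ k, (c.A j k : RatFunc ℂ) * x k = 0) : x = 0 := by
  have hdet : (c.A.map (Int.cast : ℤ → RatFunc ℂ)).det ≠ 0 := by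
    have := (Int.castRingHom (RatFunc ℂ)).map_det c.A
    rw [RingHom.mapMatrix_apply] at this
    change (c.A.map (Int.castRingHom (RatFunc ℂ))).det ≠ 0
    rw [← this]
    simpa using cartanMatrix_det_ne_zero c
  exact Matrix.eq_zero_of_mulVec_eq_zero hdet (funext hx)

theorem cartanMatrix_self (j : ι) : c.A j j = 2 := by
  have h := c.lie_h_e j j
  rw [(c.sl2 j).lie_h_e_smul ℂ, ← Int.cast_smul_eq_zsmul ℂ] at h
  exact_mod_cast (smul_left_injective ℂ (c.sl2 j).e_ne_zero h).symm

/-- The relation between the action of the torus on `W_j` and `ρ_j`. -/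
theorem mul_loweredFactor_mul (Λ : ι → ℂ[X]) (t : ι → (RatFunc ℂ)ˣ) (j : ι) :
    algebraMap ℂ[X] (RatFunc ℂ) (Λ j) * loweredFactor c t j * t j
      = rho c Λ (fun k => (t k : RatFunc ℂ)) j := by
  rw [rho, mul_assoc, loweredFactor, ← Finset.mul_prod_erase _ _ (Finset.mem_univ j)]
  -- As `a_jj = 2`, the factor `k = j` is `t_j⁻²`, which cancels the two other occurrences of `t_j`.
  have h : t j ^ (-c.A j j) = (t j)⁻¹ * (t j)⁻¹ := by
    rw [cartanMatrix_self, zpow_neg, ← mul_inv, zpow_ofNat, sq]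
  rw [h]
  have h2 : t j * ((t j)⁻¹ * (t j)⁻¹ * ∏ k ∈ Finset.univ.erase j, t k ^ (-c.A j k)) * t j
      = ∏ k ∈ Finset.univ.erase j, t k ^ (-c.A j k) := by
    generalize ∏ k ∈ Finset.univ.erase j, t k ^ (-c.A j k) = P
    rw [← mul_assoc, mul_inv_cancel_left, mul_right_comm, inv_mul_cancel, one_mul]
  rw [← Units.val_mul, h2, Units.coe_prod]
  congr 1
  exact Finset.prod_congr rfl fun k _ => Units.val_zpow_eq_zpow_val _ _

/-- The Plücker condition determines the `t_k` only up to constants; this tracks their effect on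
`ρ_j`. -/
theorem rho_C_mul (Λ : ι → ℂ[X]) (a : ι → ℂ) (y : ι → RatFunc ℂ) (j : ι) :
    rho c Λ (fun k => RatFunc.C (a k) * y k) j
      = RatFunc.C (∏ k ∈ Finset.univ.erase j, a k ^ (-cartan c k j)) * rho c Λ y j := by
  simp only [rho, mul_zpow, Finset.prod_mul_distrib, map_prod, map_zpow₀]
  ring

variable [FiniteDimensional ℂ L] in
theorem rho_algebraMap (Λ : ι → ℂ[X]) (q : ι → ℂ[X]) (j : ι) :
    rho c Λ (fun k => algebraMap ℂ[X] (RatFunc ℂ) (q k)) j = algebraMap ℂ[X] (RatFunc ℂ)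
      (Λ j * ∏ k ∈ Finset.univ.erase j, q k ^ (-cartan c k j).toNat) := by
  rw [rho, map_mul, map_prod]
  congr 1
  refine Finset.prod_congr rfl fun k hk => ?_
  have h : cartan c k j ≤ 0 := cartanMatrix_nonpos c (Finset.ne_of_mem_erase hk).symm
  rw [map_pow, ← zpow_natCast, Int.toNat_of_nonneg (by omega)]

/-! ### The connection on the planes `W_i` -/

theorem nabla_add (A : RatFunc ℂ ⊗[ℂ] L) (j : ι) (w z : RatFunc ℂ ⊗[ℂ] V j) :
    nabla A j (w + z) = nabla A j w + nabla A j z := by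
  rw [nabla, nabla, nabla, map_add, lie_add]
  abel

theorem nabla_smul (A : RatFunc ℂ ⊗[ℂ] L) (j : ι) (a : RatFunc ℂ) (w : RatFunc ℂ ⊗[ℂ] V j) :
    nabla A j (a • w) = ratDeriv a • w + a • nabla A j w := by
  have h : ratDeriv.rTensor (V j) (a • w) = ratDeriv a • w + a • ratDeriv.rTensor (V j) w := by
    induction w using TensorProduct.induction_on with
    | zero => simp
    | tmul b v =>
      simp only [TensorProduct.smul_tmul', LinearMap.rTensor_tmul, smul_eq_mul, ratDeriv_mul,
        TensorProduct.add_tmul]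
    | add w z hw hz =>
      rw [smul_add, map_add, hw, hz, map_add, smul_add, smul_add]
      abel
  rw [nabla, nabla, h, lie_smul, smul_add, add_assoc]

variable {ν : ∀ i, V i}

/-- Reading `Z^H` as the case `Λ = 0` of the Miura form lets the same formulas serve both sides of a
gauge identity. -/
theorem one_tmul_twist (ζ : ι → ℂ) :
    (1 : RatFunc ℂ) ⊗ₜ[ℂ] twist c ζ = miuraForm c 0 fun i => RatFunc.C (ζ i) := by
  rw [twist, miuraForm, TensorProduct.tmul_sum]
  simp only [Pi.zero_apply, map_zero, TensorProduct.zero_tmul, Finset.sum_const_zero, add_zero]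
  refine Finset.sum_congr rfl fun i _ => ?_
  rw [← TensorProduct.smul_tmul]
  congr 1
  rw [Algebra.smul_def, mul_one]
  rfl

section

variable (hν : ∀ i, IsFundamentalRep c i (V i) (ν i))
include hν

theorem nabla_miuraForm_highest (Λ : ι → ℂ[X]) (u : ι → RatFunc ℂ) (j : ι) (a : RatFunc ℂ) :
    nabla (miuraForm c Λ u) j (a ⊗ₜ ν j) = (ratDeriv a + u j * a) ⊗ₜ ν j := by
  rw [nabla, LinearMap.rTensor_tmul, miuraForm, add_lie, sum_lie, sum_lie, TensorProduct.add_tmul]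
  simp [LieAlgebra.ExtendScalars.bracket_tmul, (hν j).raise, (hν j).weight, TensorProduct.tmul_ite]

theorem nabla_miuraForm_lowered (Λ : ι → ℂ[X]) (u : ι → RatFunc ℂ) (j : ι) (a : RatFunc ℂ) :
    nabla (miuraForm c Λ u) j (a ⊗ₜ ⁅c.f j, ν j⁆)
      = (ratDeriv a + loweredWeight c u j * a) ⊗ₜ ⁅c.f j, ν j⁆
        + (algebraMap ℂ[X] (RatFunc ℂ) (Λ j) * a) ⊗ₜ ν j := by
  rw [nabla, LinearMap.rTensor_tmul, miuraForm, add_lie, sum_lie, sum_lie, TensorProduct.add_tmul,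
    ← add_assoc]
  congr 1
  · congr 1
    simp only [LieAlgebra.ExtendScalars.bracket_tmul, (hν j).lie_h_lie_f_self]
    have : ∀ (x : ℤ) (b : RatFunc ℂ), b ⊗ₜ[ℂ] ((x : ℂ) • ⁅c.f j, ν j⁆)
        = ((x : RatFunc ℂ) * b) ⊗ₜ[ℂ] ⁅c.f j, ν j⁆ := by
      intro x b
      rw [← TensorProduct.smul_tmul, Int.cast_smul_eq_zsmul, zsmul_eq_mul]
    simp only [this]
    rw [← TensorProduct.sum_tmul, loweredWeight]
    congr 1
    push_cast
    simp only [sub_mul, Finset.sum_sub_distrib, Finset.sum_mul, ite_mul, one_mul, zero_mul,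
      Finset.sum_ite_eq', Finset.mem_univ, if_true, mul_assoc]
  · simp [LieAlgebra.ExtendScalars.bracket_tmul, (hν j).lie_e_lie_f_self, TensorProduct.tmul_ite]

theorem nabla_comm_highest_iff (Λ Λ' : ι → ℂ[X]) (u v : ι → RatFunc ℂ) {g : Ambient V}
    {t : ι → (RatFunc ℂ)ˣ} {s : ι → RatFunc ℂ} (hg : ActsOnPlanes c ν g t s) (j : ι) :
    nabla (miuraForm c Λ u) j (g j (1 ⊗ₜ ν j)) = g j (nabla (miuraForm c Λ' v) j (1 ⊗ₜ ν j)) ↔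
      logDer (t j) = v j - u j := by
  obtain ⟨φ, h1, -, -⟩ := exists_baseChange_highestWeightFunctional hν j
  rw [(hg j).1, nabla_miuraForm_highest hν, nabla_miuraForm_highest hν, apply_tmul, (hg j).1,
    TensorProduct.smul_tmul', smul_eq_mul, ratDeriv_one, zero_add, mul_one,
    ratDeriv_eq_logDer_mul]
  have ht : (t j : RatFunc ℂ) ≠ 0 := (t j).ne_zero
  constructor
  · intro h
    have h2 := congrArg φ h
    rw [h1, h1, ← add_mul] at h2
    rw [← mul_right_cancel₀ ht h2, add_sub_cancel_right]
  · intro h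
    rw [h]
    congr 1
    ring

theorem nabla_apply_lowered (Λ Λ' : ι → ℂ[X]) (u v : ι → RatFunc ℂ) {g : Ambient V}
    {t : ι → (RatFunc ℂ)ˣ} {s : ι → RatFunc ℂ} (hg : ActsOnPlanes c ν g t s) (j : ι) :
    nabla (miuraForm c Λ u) j (g j (1 ⊗ₜ ⁅c.f j, ν j⁆))
      = ((logDer (loweredFactor c t j) + loweredWeight c u j) * loweredFactor c t j)
          ⊗ₜ ⁅c.f j, ν j⁆
        + (ratDeriv (s j) + u j * s j
          + algebraMap ℂ[X] (RatFunc ℂ) (Λ j) * loweredFactor c t j) ⊗ₜ ν j ∧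
    g j (nabla (miuraForm c Λ' v) j (1 ⊗ₜ ⁅c.f j, ν j⁆))
      = (loweredWeight c v j * loweredFactor c t j) ⊗ₜ ⁅c.f j, ν j⁆
        + (loweredWeight c v j * s j + algebraMap ℂ[X] (RatFunc ℂ) (Λ' j) * t j) ⊗ₜ ν j := by
  constructor
  · rw [(hg j).2, nabla_add, nabla_miuraForm_highest hν, nabla_miuraForm_lowered hν,
      ratDeriv_eq_logDer_mul, add_assoc, ← TensorProduct.add_tmul, add_mul]
    congr 2
    ring
  · rw [nabla_miuraForm_lowered hν, ratDeriv_one, zero_add, mul_one, mul_one, map_add, apply_tmul,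
      (hg j).2, apply_tmul _ _ (algebraMap _ _ _), (hg j).1, smul_add]
    simp only [TensorProduct.smul_tmul', smul_eq_mul]
    rw [add_assoc, ← TensorProduct.add_tmul]

/-- This is the coefficient of `ν_j`, isolated by the highest weight functional, which kills `f_j
ν_j`. -/
theorem eq_of_nabla_comm_lowered (Λ Λ' : ι → ℂ[X]) (u v : ι → RatFunc ℂ) {g : Ambient V}
    {t : ι → (RatFunc ℂ)ˣ} {s : ι → RatFunc ℂ} (hg : ActsOnPlanes c ν g t s) (j : ι)
    (h : nabla (miuraForm c Λ u) j (g j (1 ⊗ₜ ⁅c.f j, ν j⁆))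
      = g j (nabla (miuraForm c Λ' v) j (1 ⊗ₜ ⁅c.f j, ν j⁆))) :
    ratDeriv (s j) + u j * s j + algebraMap ℂ[X] (RatFunc ℂ) (Λ j) * loweredFactor c t j
      = loweredWeight c v j * s j + algebraMap ℂ[X] (RatFunc ℂ) (Λ' j) * t j := by
  obtain ⟨φ, h1, h2, -⟩ := exists_baseChange_highestWeightFunctional hν j
  obtain ⟨e1, e2⟩ := nabla_apply_lowered hν Λ Λ' u v hg j
  rw [e1, e2] at h
  have h3 := congrArg φ h
  simpa only [map_add, h1, h2, zero_add] using h3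

/-- By the Leibniz rule it suffices to test `ν_j` and `f_j ν_j`. The coefficient of `f_j ν_j`
imposes nothing new: it follows from the logarithmic derivatives of the `t_k`. -/
theorem nabla_comm_plane (Λ Λ' : ι → ℂ[X]) (u v : ι → RatFunc ℂ) {g : Ambient V}
    {t : ι → (RatFunc ℂ)ˣ} {s : ι → RatFunc ℂ} (hg : ActsOnPlanes c ν g t s)
    (ht : ∀ j, logDer (t j) = v j - u j)
    (hs : ∀ j, ratDeriv (s j) + u j * s j
        + algebraMap ℂ[X] (RatFunc ℂ) (Λ j) * loweredFactor c t j
      = loweredWeight c v j * s j + algebraMap ℂ[X] (RatFunc ℂ) (Λ' j) * t j)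
    (j : ι) (w : RatFunc ℂ ⊗[ℂ] V j) (hw : w ∈ (plane c ν j).baseChange (RatFunc ℂ)) :
    nabla (miuraForm c Λ u) j (g j w) = g j (nabla (miuraForm c Λ' v) j w) := by
  rw [plane, Submodule.baseChange_span] at hw
  induction hw using Submodule.span_induction with
  | mem w hw =>
    obtain ⟨x, rfl | rfl, rfl⟩ := hw
    · exact (nabla_comm_highest_iff hν Λ Λ' u v hg j).2 (ht j)
    · obtain ⟨e1, e2⟩ := nabla_apply_lowered hν Λ Λ' u v hg j
      change nabla _ j (g j (1 ⊗ₜ ⁅c.f j, ν j⁆)) = g j (nabla _ j (1 ⊗ₜ ⁅c.f j, ν j⁆))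
      have h : logDer (loweredFactor c t j) = loweredWeight c v j - loweredWeight c u j := by
        rw [logDer_loweredFactor, ← loweredWeight_sub]
        congr 1
        exact funext ht
      rw [e1, e2, hs, h, sub_add_cancel]
  | zero => simp [nabla]
  | add w z _ _ hw hz => rw [map_add, nabla_add, nabla_add, map_add, hw, hz]
  | smul a w _ hw => rw [map_smul, nabla_smul, nabla_smul, map_add, map_smul, map_smul, hw]

end

end Connections

/-! ### The correspondence between opers and the `qq`-system -/

section Correspondence

variable {ι : Type*} [Fintype ι] [DecidableEq ι]
  {L : Type*} [LieRing L] [LieAlgebra ℂ L] {H : LieSubalgebra ℂ L}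
  {c : LieAlgebra.Basis ι H}
  {V : ι → Type*} [∀ i, AddCommGroup (V i)] [∀ i, Module ℂ (V i)]
  [∀ i, LieRingModule L (V i)] [∀ i, LieModule ℂ L (V i)]

variable (c) in
theorem sum_tmul_h_mem_lieBorelMinus (u : ι → RatFunc ℂ) :
    ∑ i, u i ⊗ₜ[ℂ] c.h i ∈ (lieBorelMinus c).baseChange (RatFunc ℂ) :=
  sum_mem fun i _ => Submodule.tmul_mem_baseChange_of_mem _
    (LieSubalgebra.subset_lieSpan (Or.inr ⟨i, rfl⟩))

variable (c) in
theorem miuraForm_mem_lieBorelPlus (Λ : ι → ℂ[X]) (u : ι → RatFunc ℂ) :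
    miuraForm c Λ u ∈ (lieBorelPlus c).baseChange (RatFunc ℂ) :=
  add_mem
    (sum_mem fun i _ => Submodule.tmul_mem_baseChange_of_mem _
      (LieSubalgebra.subset_lieSpan (Or.inr ⟨i, rfl⟩)))
    (sum_mem fun i _ => Submodule.tmul_mem_baseChange_of_mem _
      (LieSubalgebra.subset_lieSpan (Or.inl ⟨i, rfl⟩)))

variable (c V) in
/-- The connection `∂_z + ∑ u_i α̌_i + ∑ Λ_i e_i` with the standard reductions. -/
noncomputable def standardPreOper (Λ : ι → ℂ[X]) (u : ι → RatFunc ℂ) : PreOper c V :=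
  ⟨miuraForm c Λ u, ((1 : Gz c V) : Gz c V ⧸ borelMinus c V),
    ((1 : Gz c V) : Gz c V ⧸ borelPlus c V)⟩

theorem standardPreOper_hasOperForm (Λ : ι → ℂ[X]) (u : ι → RatFunc ℂ) :
    (standardPreOper c V Λ u).HasOperForm fun i => algebraMap ℂ[X] (RatFunc ℂ) (Λ i) := by
  refine ⟨1, rfl, _, sum_tmul_h_mem_lieBorelMinus c u, ?_⟩
  rw [add_comm]
  exact IsGauge.one _

variable (c V) in
/-- The Miura oper with connection `∂_z + ∑ u_i α̌_i + ∑ Λ_i e_i` and standard reductions. -/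
noncomputable def standardOper {Λ : ι → ℂ[X]} (hΛ : ∀ i, Λ i ≠ 0) (u : ι → RatFunc ℂ) : MiuraOper c V Λ where
  toPreOper := standardPreOper c V Λ u
  isOper := ⟨_, fun i => RatFunc.algebraMap_ne_zero (hΛ i), standardPreOper_hasOperForm Λ u⟩
  regular := standardPreOper_hasOperForm Λ u
  preserves := ⟨1, rfl, _, miuraForm_mem_lieBorelPlus c Λ u, IsGauge.one _⟩

theorem mem_closure_of_mk_eq_plus {g h : Gz c V}
    (e : (g : Gz c V ⧸ borelPlus c V) = (h : Gz c V ⧸ borelPlus c V)) :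
    (g : Ambient V)⁻¹ * (h : Ambient V)
      ∈ Subgroup.closure (torusElements c V ∪ raisingElements c V) :=
  Subgroup.mem_subgroupOf.1 (QuotientGroup.eq.1 e)

theorem mem_closure_of_mk_eq_minus {g h : Gz c V}
    (e : (g : Gz c V ⧸ borelMinus c V) = (h : Gz c V ⧸ borelMinus c V)) :
    (g : Ambient V)⁻¹ * (h : Ambient V)
      ∈ Subgroup.closure (torusElements c V ∪ loweringElements c V) :=
  Subgroup.mem_subgroupOf.1 (QuotientGroup.eq.1 e)

section

variable {ν : ∀ i, V i} (hν : ∀ i, IsFundamentalRep c i (V i) (ν i))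
include hν

/-- Isomorphic opers with standard reductions and the same `Λ_i` have the same Cartan connection. -/
theorem eq_of_standardOper_iso {Λ : ι → ℂ[X]} (hΛ : ∀ i, Λ i ≠ 0) {u v : ι → RatFunc ℂ}
    (h : (standardOper c V hΛ u).Iso (standardOper c V hΛ v)) : u = v := by
  obtain ⟨g, hg, hm, hp⟩ := h
  have hm' := mem_closure_of_mk_eq_minus (h := g * 1) hm
  have hp' := mem_closure_of_mk_eq_plus (h := g * 1) hp
  simp only [Subgroup.coe_one, inv_one, one_mul, mul_one] at hm' hp'
  obtain ⟨t, s, hts⟩ := exists_actsOnPlanes_of_mem hν hp'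
  have hlog : ∀ j, logDer (t j) = v j - u j := fun j =>
    (nabla_comm_highest_iff hν Λ Λ u v hts j).1 (hg j _)
  -- Since `g` is also in `B₋`, it scales the highest weight functional, which kills `f_j ν_j`;
  -- hence `s j = 0`. The coefficient of `ν_j` then reduces to `Λ_j` times the lowered factor being
  -- `Λ_j t_j`.
  have hx : ∀ j, loweredFactor c t j = t j := by
    intro j
    obtain ⟨φ, h1, h2, h3⟩ := exists_baseChange_highestWeightFunctional hν j
    obtain ⟨a, ha⟩ := h3 _ hm'
    have hs : s j = 0 := by
      have := ha (1 ⊗ₜ ⁅c.f j, ν j⁆)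
      rwa [(hts j).2, map_add, h1, h2, h2, mul_zero, zero_add] at this
    have h4 := eq_of_nabla_comm_lowered hν Λ Λ u v hts j (hg j _)
    rw [hs, map_zero, mul_zero, mul_zero, zero_add, zero_add, zero_add] at h4
    exact Units.ext (mul_left_cancel₀ (RatFunc.algebraMap_ne_zero (hΛ j)) h4)
  -- Taking logarithmic derivatives of `hx` gives a vector in the kernel of the Cartan matrix.
  have hzero : (fun j => logDer (t j)) = 0 := by
    refine eq_zero_of_sum_cartanMatrix_mul_eq_zero (c := c) fun j => ?_
    have := logDer_loweredFactor (c := c) t j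
    rw [hx, loweredWeight] at this
    linear_combination this
  ext1 j
  have := congrFun hzero j
  rw [hlog, Pi.zero_apply, sub_eq_zero] at this
  exact this.symm

/-- The trivialization has diagonal data `q₊` and off-diagonal entries `-q₋`. The equation for the
latter, multiplied by `q₊^j`, is the `j`-th equation of the `qq`-system. -/
theorem isTwistedMiuraPlucker_standardOper {Λ : ι → ℂ[X]} (hΛ : ∀ i, Λ i ≠ 0) {ζ : ι → ℂ}
    [FiniteDimensional ℂ L] (s : QQSolution c Λ ζ) (hs : ∀ i, s.qPlus i ≠ 0) :
    (standardOper c V hΛ s.cartanPart).IsTwistedMiuraPlucker ν (twist c ζ) := by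
  let t : ι → (RatFunc ℂ)ˣ := fun i => Units.mk0 _ (RatFunc.algebraMap_ne_zero (hs i))
  let σ : ι → RatFunc ℂ := fun i => -algebraMap ℂ[X] (RatFunc ℂ) (s.qMinus i)
  obtain ⟨g, hg, hgt⟩ := exists_mem_actsOnPlanes hν t σ
  have hgG : g ∈ Gz c V := Subgroup.closure_mono Set.subset_union_left hg
  refine ⟨⟨g, hgG⟩, ?_, ?_⟩
  · refine (QuotientGroup.eq.2 ?_).symm
    rw [inv_one, one_mul]
    exact Subgroup.mem_subgroupOf.2 hg
  · intro j w hw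
    rw [one_tmul_twist]
    refine nabla_comm_plane hν Λ 0 _ _ hgt (fun j => ?_) (fun j => ?_) j w hw
    · simp [QQSolution.cartanPart, logDer, t]
    · have hq : algebraMap ℂ[X] (RatFunc ℂ) (s.qPlus j) ≠ 0 := RatFunc.algebraMap_ne_zero (hs j)
      have h1 := mul_loweredFactor_mul (c := c) Λ t j
      have h2 := congrArg (algebraMap ℂ[X] (RatFunc ℂ)) (s.eqn j)
      rw [← rho_algebraMap] at h2
      rw [show (fun k => (t k : RatFunc ℂ)) = fun k => algebraMap ℂ[X] (RatFunc ℂ) (s.qPlus k)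
        from rfl, ← h2, show (t j : RatFunc ℂ) = algebraMap ℂ[X] (RatFunc ℂ) (s.qPlus j) from rfl]
        at h1
      rw [loweredWeight_C]
      simp only [wronskian, map_add, map_sub, map_mul, RatFunc.algebraMap_C] at h1
      simp only [σ, map_neg, QQSolution.cartanPart, ratDeriv_algebraMap, Pi.zero_apply, map_zero,
        zero_mul, add_zero]
      apply mul_right_cancel₀ hq
      rw [add_mul, h1]
      field_simp
      ring

end

/-- A root of `ρ_i` is a root of `Λ_i` or of some `q₊^k` with `k ≠ i` and `a_{ki} ≠ 0`; both are
excluded as roots of `q₊^i`. -/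
theorem isNondegenerateSL2 [FiniteDimensional ℂ L] {Λ : ι → ℂ[X]} (hΛ : ∀ i, Λ i ≠ 0) {ζ : ι → ℂ}
    (s : QQSolution c Λ ζ) (hs : s.IsNondegenerate) (i : ι) :
    IsNondegenerateSL2 (ζ i) (s.cartanPart i)
      (rho c Λ (fun k => algebraMap ℂ[X] (RatFunc ℂ) (s.qPlus k)) i) := by
  obtain ⟨h1, h2, h3, h4⟩ := (hNondegConditions_algebraMap_iff _ _ _).1 hs.2
  rw [rho_algebraMap]
  refine ⟨⟨_, ?_, rfl⟩, s.qPlus i, rfl, ?_⟩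
  · exact mul_ne_zero (hΛ i) (Finset.prod_ne_zero_iff.2 fun k _ => pow_ne_zero _ (h1 k))
  · rw [hNondegConditions_algebraMap_iff]
    refine ⟨fun _ => h1 i, fun _ => h2 i, fun _ w hw hi => ?_, fun _ _ h => absurd rfl h⟩
    rw [IsRoot.def, eval_mul, eval_prod, mul_eq_zero, Finset.prod_eq_zero_iff] at hw
    rcases hw with hw | ⟨k, hk, hw⟩
    · exact h3 i w hw hi
    · rw [eval_pow] at hw
      have hk0 : cartan c k i ≠ 0 := by
        intro h
        simp [h] at hw
      exact h4 k i (Finset.ne_of_mem_erase hk) hk0 w (by by_contra h0; exact pow_ne_zero _ h0 hw) hi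

theorem standardOper_mem [FiniteDimensional ℂ L] {ν : ∀ i, V i}
    (hν : ∀ i, IsFundamentalRep c i (V i) (ν i)) {Λ : ι → ℂ[X]} (hΛ : ∀ i, Λ i ≠ 0) {ζ : ι → ℂ}
    (s : QQSolution c Λ ζ) (hs : s.IsNondegenerate) :
    (⟦standardOper c V hΛ s.cartanPart⟧ : MiuraOperClass c V Λ)
      ∈ NondegMiuraPluckerOpers c Λ ν ζ :=
  ⟨_, rfl, isTwistedMiuraPlucker_standardOper hν hΛ s fun i => (hs.1 i).ne_zero,
    s.cartanPart, _, ⟨1, rfl, rfl, IsGauge.one _⟩, fun _ => rfl, hs.2, isNondegenerateSL2 hΛ s hs⟩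

theorem standardOper_iso_of_hasMiuraForm {Λ : ι → ℂ[X]} (hΛ : ∀ i, Λ i ≠ 0) {u : ι → RatFunc ℂ}
    {x : MiuraOper c V Λ} (hx : x.HasMiuraForm u) : x.Iso (standardOper c V hΛ u) := by
  obtain ⟨g, hm, hp, hg⟩ := hx
  refine ⟨g, hg, ?_, ?_⟩
  · rw [← hm]
    change _ = ((g * 1 : Gz c V) : Gz c V ⧸ borelMinus c V)
    rw [mul_one]
  · rw [← hp]
    change _ = ((g * 1 : Gz c V) : Gz c V ⧸ borelPlus c V)
    rw [mul_one]

/-- The functions `y_i` of a nondegenerate oper can be replaced by monic polynomials. -/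
theorem exists_monic_of_nondegenerate {Λ : ι → ℂ[X]} {ζ : ι → ℂ} {u y : ι → RatFunc ℂ}
    (hu : ∀ i, u i = RatFunc.C (ζ i) - (y i)⁻¹ * ratDeriv (y i))
    (hy : HNondegConditions (cartan c) (fun i => algebraMap ℂ[X] (RatFunc ℂ) (Λ i)) y)
    (h2 : ∀ i, IsNondegenerateSL2 (ζ i) (u i) (rho c Λ y i)) :
    ∃ q : ι → ℂ[X], (∀ i, (q i).Monic) ∧
      (∀ i, u i = RatFunc.C (ζ i) - (algebraMap ℂ[X] (RatFunc ℂ) (q i))⁻¹ *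
        ratDeriv (algebraMap ℂ[X] (RatFunc ℂ) (q i))) ∧
      HNondegConditions (cartan c) (fun i => algebraMap ℂ[X] (RatFunc ℂ) (Λ i))
        (fun i => algebraMap ℂ[X] (RatFunc ℂ) (q i)) := by
  have h : ∀ i, ∃ q : ℂ[X], q.Monic ∧ ∃ a : ℂ, a ≠ 0 ∧
      y i = RatFunc.C a * algebraMap ℂ[X] (RatFunc ℂ) q := by
    intro i
    -- The polynomial `p` of the `SL(2)`-oper has the same logarithmic derivative as `y i`, so `y i`
    -- is a constant multiple of it.
    obtain ⟨-, p, hp, hN⟩ := h2 i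
    have hp0 : p ≠ 0 := fun h => hN.ne_zero () (by rw [h, map_zero])
    obtain ⟨a, ha, hya⟩ := exists_C_mul_of_logDeriv_eq (hy.ne_zero i)
      (RatFunc.algebraMap_ne_zero hp0) (by linear_combination hu i - hp)
    have hlc : p.leadingCoeff ≠ 0 := leadingCoeff_ne_zero.2 hp0
    refine ⟨C p.leadingCoeff⁻¹ * p, ?_, a * p.leadingCoeff, mul_ne_zero ha hlc, ?_⟩
    · rw [mul_comm]; exact monic_mul_leadingCoeff_inv hp0
    · have hC : RatFunc.C p.leadingCoeff * RatFunc.C p.leadingCoeff⁻¹ = 1 := by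
        rw [← map_mul, mul_inv_cancel₀ hlc, map_one]
      rw [hya, map_mul, map_mul, RatFunc.algebraMap_C]
      linear_combination -(RatFunc.C a * algebraMap ℂ[X] (RatFunc ℂ) p) * hC
  choose q hq a ha hya using h
  refine ⟨q, hq, fun i => ?_, ?_⟩
  · rw [hu, hya, logDeriv_C_mul (ha i)]
  · have hy' : y = fun i => algebraMap ℂ[X] (RatFunc ℂ) (C (a i) * q i) := by
      ext1 i
      rw [hya, map_mul, RatFunc.algebraMap_C]
    have hroot : ∀ i w, (C (a i) * q i).IsRoot w ↔ (q i).IsRoot w := by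
      intro i w
      simp [IsRoot.def, ha i]
    have hmult : ∀ i w, (C (a i) * q i).rootMultiplicity w = (q i).rootMultiplicity w := by
      intro i w
      rw [rootMultiplicity_mul (mul_ne_zero (C_ne_zero.2 (ha i)) (hq i).ne_zero),
        rootMultiplicity_C, zero_add]
    rw [hy', hNondegConditions_algebraMap_iff] at hy
    rw [hNondegConditions_algebraMap_iff]
    simp only [hroot, hmult] at hy
    exact ⟨fun i => (hq i).ne_zero, hy.2⟩

/-- The Miura form and the Plücker condition use two trivializations of the same `B₊`-reduction.
Their ratio lies in `B₊`, and its off-diagonal entry on `W_i`, suitably normalized, is `q₋^i`. -/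
theorem exists_qMinus [FiniteDimensional ℂ L] {ν : ∀ i, V i}
    (hν : ∀ i, IsFundamentalRep c i (V i) (ν i)) {Λ : ι → ℂ[X]} {ζ : ι → ℂ} {x : MiuraOper c V Λ}
    (hx : x.IsTwistedMiuraPlucker ν (twist c ζ)) {q : ι → ℂ[X]} (hq0 : ∀ i, q i ≠ 0)
    (hq : ∀ i w, (q i).rootMultiplicity w ≤ 1)
    (hxq : x.HasMiuraForm fun i => RatFunc.C (ζ i) - (algebraMap ℂ[X] (RatFunc ℂ) (q i))⁻¹ *
      ratDeriv (algebraMap ℂ[X] (RatFunc ℂ) (q i))) (i : ι) :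
    ∃ p : ℂ[X], wronskian (q i) p + C (rootPairing c ζ i) * (q i * p)
      = Λ i * ∏ j ∈ Finset.univ.erase i, q j ^ (-cartan c j i).toNat := by
  obtain ⟨g, -, hgp, hg⟩ := hxq
  obtain ⟨b, hbp, hb⟩ := hx
  obtain ⟨t, s, hts⟩ := exists_actsOnPlanes_of_mem hν
    (mem_closure_of_mk_eq_plus (hgp.trans hbp.symm))
  set u : ι → RatFunc ℂ := fun i => RatFunc.C (ζ i) - (algebraMap ℂ[X] (RatFunc ℂ) (q i))⁻¹ *
      ratDeriv (algebraMap ℂ[X] (RatFunc ℂ) (q i)) with hu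
  have hQ : ∀ j, algebraMap ℂ[X] (RatFunc ℂ) (q j) ≠ 0 := fun j => RatFunc.algebraMap_ne_zero (hq0 j)
  have key : ∀ j, ∀ w ∈ (plane c ν j).baseChange (RatFunc ℂ),
      nabla (miuraForm c Λ u) j (((g : Ambient V)⁻¹ * (b : Ambient V)) j w)
        = ((g : Ambient V)⁻¹ * (b : Ambient V)) j
          (nabla (miuraForm c 0 fun i => RatFunc.C (ζ i)) j w) := by
    intro j w hw
    have h1 := hb j w hw
    rw [one_tmul_twist] at h1
    have h2 := hg.inv j ((b : Ambient V) j w)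
    rw [h1] at h2
    exact h2
  have hlog : ∀ j, logDer (t j) = (algebraMap ℂ[X] (RatFunc ℂ) (q j))⁻¹ *
      ratDeriv (algebraMap ℂ[X] (RatFunc ℂ) (q j)) := by
    intro j
    have := (nabla_comm_highest_iff hν Λ 0 u _ hts j).1
      (key j _ (Submodule.tmul_mem_baseChange_of_mem _ (Submodule.subset_span (Or.inl rfl))))
    rw [this, hu]
    ring
  have ht : ∀ j, ∃ a : ℂ, a ≠ 0 ∧
      (t j : RatFunc ℂ) = RatFunc.C a * algebraMap ℂ[X] (RatFunc ℂ) (q j) := fun j =>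
    exists_C_mul_of_logDeriv_eq (t j).ne_zero (hQ j) (hlog j)
  choose a ha hta using ht
  have hs := eq_of_nabla_comm_lowered hν Λ 0 u _ hts i
    (key i _ (Submodule.tmul_mem_baseChange_of_mem _ (Submodule.subset_span (Or.inr rfl))))
  have hrho := mul_loweredFactor_mul (c := c) Λ t i
  rw [funext hta, rho_C_mul, rho_algebraMap] at hrho
  set ρ := Λ i * ∏ j ∈ Finset.univ.erase i, q j ^ (-cartan c j i).toNat with hρ
  set α := ∏ k ∈ Finset.univ.erase i, a k ^ (-cartan c k i) with hα
  have hα0 : RatFunc.C α ≠ 0 := (_root_.map_ne_zero _).2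
    (Finset.prod_ne_zero_iff.2 fun k _ => zpow_ne_zero _ (ha k))
  have ha0 : RatFunc.C (a i) ≠ 0 := (_root_.map_ne_zero _).2 (ha i)
  rw [loweredWeight_C, Pi.zero_apply, map_zero, zero_mul, add_zero] at hs
  have hQi := hQ i
  set Q := algebraMap ℂ[X] (RatFunc ℂ) (q i) with hQdef
  -- Dividing `s i` by `q i` absorbs the term in `q'/q`. The factor `a i / α` undoes the constants
  -- in `t_k = a_k q_k`, and the sign matches `s = -q₋`.
  set r : RatFunc ℂ := -(RatFunc.C (a i / α)) * (s i * Q⁻¹) with hr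
  have hr' : (ratDeriv r + RatFunc.C (rootPairing c ζ i) * r) * Q ^ 2
      = algebraMap ℂ[X] (RatFunc ℂ) ρ := by
    rw [hr, ← map_neg, ratDeriv_mul, ratDeriv_C, ratDeriv_mul, ratDeriv_inv hQi, map_neg, map_div₀]
    rw [hta] at hrho
    simp only [hu] at hs
    rw [← hQdef] at hs hrho
    generalize loweredFactor c t i = x at hs hrho
    field_simp at hs ⊢
    linear_combination hrho - RatFunc.C (a i) * hs
  -- Simplicity of the roots of `q i` turns the rational solution into a polynomial divided by `q
  -- i`.
  obtain ⟨p, hp⟩ := exists_eq_div_of_ratDeriv_add_eq (hq0 i) (hq i) _ hr'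
  refine ⟨p, RatFunc.algebraMap_injective ℂ ?_⟩
  rw [← hr', hp, ratDeriv_div _ _ (hq0 i)]
  simp only [wronskian, map_add, map_sub, map_mul, RatFunc.algebraMap_C]
  rw [← hQdef]
  field_simp

theorem qPlus_eq_of_cartanPart_eq {Λ : ι → ℂ[X]} {ζ : ι → ℂ} {s t : QQSolution c Λ ζ}
    (hs : ∀ i, (s.qPlus i).Monic) (ht : ∀ i, (t.qPlus i).Monic) (h : s.cartanPart = t.cartanPart) :
    s.qPlus = t.qPlus := by
  ext1 i
  have h1 := congrFun h i
  rw [QQSolution.cartanPart, QQSolution.cartanPart, sub_right_inj] at h1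
  obtain ⟨a, -, h2⟩ := exists_C_mul_of_logDeriv_eq (RatFunc.algebraMap_ne_zero (hs i).ne_zero)
    (RatFunc.algebraMap_ne_zero (ht i).ne_zero) h1
  rw [← RatFunc.algebraMap_C, ← map_mul] at h2
  have h3 := RatFunc.algebraMap_injective ℂ h2
  have h4 := congrArg leadingCoeff h3
  rw [leadingCoeff_mul, leadingCoeff_C, (hs i).leadingCoeff, (ht i).leadingCoeff, mul_one] at h4
  rw [h3, ← h4, C_1, one_mul]

end Correspondence

end MiuraOpers

/-! ### The main theorem -/

theorem corollary5p5 {ι : Type*} [Fintype ι] [DecidableEq ι]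
    {L : Type*} [LieRing L] [LieAlgebra ℂ L] [FiniteDimensional ℂ L] [LieAlgebra.IsSimple ℂ L]
    {H : LieSubalgebra ℂ L} (c : LieAlgebra.Basis ι H)
    (V : ι → Type*) [∀ i, AddCommGroup (V i)] [∀ i, Module ℂ (V i)]
    [∀ i, LieRingModule L (V i)] [∀ i, LieModule ℂ L (V i)]
    (ν : ∀ i, V i) (hν : ∀ i, IsFundamentalRep c i (V i) (ν i))
    (Λ : ι → Polynomial ℂ) (hΛ : ∀ i, (Λ i).Monic) (ζ : ι → ℂ) :
    ∃ F : {s : QQSolution c Λ ζ // s.IsNondegenerate} →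
        NondegMiuraPluckerOpers (V := V) c Λ ν ζ,
      -- `F` sends a solution to the class of the oper with standard reductions and connection
      -- `∂_z + ∑ (ζ_i - (q₊^i)⁻¹ ∂_z q₊^i) α̌_i + ∑ Λ_i e_i`
      (∀ s, ∃ x : MiuraOper c V Λ,
        (⟦x⟧ : MiuraOperClass c V Λ) = (F s : MiuraOperClass c V Λ) ∧
        x.redMinus = ((1 : Gz c V) : Gz c V ⧸ borelMinus c V) ∧
        x.redPlus = ((1 : Gz c V) : Gz c V ⧸ borelPlus c V) ∧
        x.conn = miuraForm c Λ s.1.cartanPart) ∧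
      Function.Surjective F ∧
      ∀ s t, F s = F t ↔ s.1.qPlus = t.1.qPlus := by
  have hΛ0 : ∀ i, Λ i ≠ 0 := fun i => (hΛ i).ne_zero
  refine ⟨fun s => ⟨_, standardOper_mem hν hΛ0 s.1 s.2⟩, fun s => ⟨_, rfl, rfl, rfl, rfl⟩, ?_, ?_⟩
  · rintro ⟨_, x, rfl, hx, u, y, hxu, hu, hy, h2⟩
    obtain ⟨q, hq, huq, hqN⟩ := exists_monic_of_nondegenerate hu hy h2
    obtain rfl := funext huq
    have hqN' := (hNondegConditions_algebraMap_iff _ _ _).1 hqN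
    choose p hp using exists_qMinus hν hx hqN'.1 hqN'.2.1 hxu
    exact ⟨⟨⟨q, p, hp⟩, hq, hqN⟩, Subtype.ext (Quotient.sound
      (Setoid.symm (standardOper_iso_of_hasMiuraForm hΛ0 hxu)))⟩
  · intro s t
    constructor
    · intro h
      exact qPlus_eq_of_cartanPart_eq s.2.1 t.2.1
        (eq_of_standardOper_iso hν hΛ0 (Quotient.exact (congrArg Subtype.val h)))
    · intro h
      have : s.1.cartanPart = t.1.cartanPart := by
        ext1 i
        rw [QQSolution.cartanPart, QQSolution.cartanPart, h]
      exact Subtype.ext (by simp only [this])
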